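/- Let $\mathbb{T}=\mathbb{R}/\mathbb{Z}$ and let $\mathbb{A}=\mathbb{T}\times[-1,1]$ be the closed cylinder with the symplectic form $\Omega=\tfrac12\,d\theta\wedge dy$. A bicurve on $\mathbb{A}$ is a union $\gamma=\gamma_-\sqcup\gamma_+$ of two disjoint embedded loops in $\mathbb{A}$ for which there are $-1\le y_-<y_+\le 1$ and a smooth diffeotopy $(f_t)_{t\in[0,1]}$ of $\mathbb{A}$ (each $f_t$ is a smooth diffeomorphism of $\mathbb{A}$, the map $(t,x)\mapsto f_t(x)$ is smooth, and $f_0=\mathrm{id}$) such that $f_1(\mathbb{T}\times\{y_-\})=\gamma_-$ and $f_1(\mathbb{T}\times\{y_+\})=\gamma_+$. Proposition. For every bicurve $\gamma$ on $\mathbb{A}$ there exist $-1\le y_-<y_+\le 1$, hence a straight bicurve $\gamma'=\mathbb{T}\times\{y_-,y_+\}$, and a smooth symplectomorphism $\phi$ of $(\mathbb{A},\Omega)$ whose support $\overline{\{x:\phi(x)\neq x\}}$ is contained in $\mathbb{T}\times(-1,1)$, such that $\phi(\gamma')=\gamma$. -/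

import Mathlib

open Set
open scoped ContDiff unitInterval

/-- The closed cylinder `𝔸 = 𝕋 × [-1, 1]`, with `𝕋 = ℝ / ℤ`. -/
abbrev Cylinder : Type := AddCircle (1 : ℝ) × Icc (-1 : ℝ) 1

namespace Cylinder

/-- The universal cover `ℝ × [-1, 1]` of the cylinder, as a subset of the plane. -/
def strip : Set (ℝ × ℝ) := univ ×ˢ Icc (-1 : ℝ) 1

/-- `F`, restricted to the strip `ℝ × [-1, 1]`, is a lift of the self-map `f` of the cylinder:
`F` followed by the covering map `(θ, y) ↦ (θ mod 1, y)` is the covering map followed by `f`.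
The values of `F` off the strip are irrelevant. -/
def IsLift (F : ℝ × ℝ → ℝ × ℝ) (f : Cylinder → Cylinder) : Prop :=
  ∀ (θ : ℝ) (y : Icc (-1 : ℝ) 1),
    ((F (θ, y)).1 : AddCircle (1 : ℝ)) = (f ((θ : AddCircle (1 : ℝ)), y)).1 ∧
    (F (θ, y)).2 = ((f ((θ : AddCircle (1 : ℝ)), y)).2 : ℝ)

/-- A self-map of the cylinder is smooth (up to the boundary) if it has a lift to the universal
cover that is smooth on the closed strip. As the strip is simply connected, every continuous
self-map has a continuous lift, and two of them differ by a constant in `ℤ × {0}`; so this is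
smoothness in the charts given by the local inverses of the covering map. -/
def IsSmooth (f : Cylinder → Cylinder) : Prop :=
  ∃ F : ℝ × ℝ → ℝ × ℝ, ContDiffOn ℝ ∞ F strip ∧ IsLift F f

/-- Smooth diffeomorphisms of the cylinder. -/
def IsDiffeo (f : Cylinder ≃ Cylinder) : Prop :=
  IsSmooth f ∧ IsSmooth f.symm

/-- A diffeotopy `(f_t)`, `t ∈ [0, 1]`, of the cylinder starting at the identity: every `f_t` is a
smooth diffeomorphism, `f_0 = id`, and `(t, x) ↦ f_t x` is smooth. -/
def IsDiffeotopy (f : I → Cylinder ≃ Cylinder) : Prop :=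
  (∀ t, IsDiffeo (f t)) ∧
  f 0 = Equiv.refl Cylinder ∧
  ∃ F : ℝ × (ℝ × ℝ) → ℝ × ℝ, ContDiffOn ℝ ∞ F (Icc (0 : ℝ) 1 ×ˢ strip) ∧
    ∀ t : I, IsLift (fun p => F ((t : ℝ), p)) (f t)

/-- The horizontal circle `𝕋 × {y}`. -/
def circle (y : Icc (-1 : ℝ) 1) : Set Cylinder := univ ×ˢ {y}

/-- The straight pair of circles `𝕋 × {y₁, y₂}`. -/
def straight (y₁ y₂ : Icc (-1 : ℝ) 1) : Set Cylinder := univ ×ˢ {y₁, y₂}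

/-- Bicurves on the cylinder: `γ = γ₋ ∪ γ₊`, where `γ₋` and `γ₊` are the images of two horizontal
circles `𝕋 × {y₋}` and `𝕋 × {y₊}` with `-1 ≤ y₋ < y₊ ≤ 1` under the end `f_1` of a diffeotopy.
(Then `γ₋` and `γ₊` are disjoint embedded loops, because `f_1` is a diffeomorphism.) -/
def IsBicurve (γ : Set Cylinder) : Prop :=
  ∃ γm γp : Set Cylinder, γ = γm ∪ γp ∧
    ∃ ym yp : Icc (-1 : ℝ) 1, ym < yp ∧
      ∃ f : I → Cylinder ≃ Cylinder, IsDiffeotopy f ∧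
        f 1 '' circle yp = γp ∧ f 1 '' circle ym = γm

/-- The canonical symplectic form `Ω = (1/2) dθ ∧ dy`, of total area `1` on the cylinder, in the
coordinates `(θ, y)`. -/
noncomputable def Omega (u v : ℝ × ℝ) : ℝ := (u.1 * v.2 - u.2 * v.1) / 2

/-- Smooth symplectomorphisms of the cylinder: smooth diffeomorphisms `φ` with `φ^* Ω = Ω`. The
pull-back is computed in the coordinates of the universal cover; it does not depend on the lift. -/
def IsSymplecto (φ : Cylinder ≃ Cylinder) : Prop :=
  IsDiffeo φ ∧
  ∃ F : ℝ × ℝ → ℝ × ℝ, ContDiffOn ℝ ∞ F strip ∧ IsLift F φ ∧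
    ∀ p ∈ strip, ∀ u v : ℝ × ℝ,
      Omega (fderivWithin ℝ F strip p u) (fderivWithin ℝ F strip p v) = Omega u v

/-- The support of `φ` (the closure of the set of the points that `φ` moves) lies in the open
cylinder `𝕋 × (-1, 1)`; being closed in the compact cylinder, it is then compact. -/
def IsCompactlySupported (φ : Cylinder ≃ Cylinder) : Prop :=
  closure {x | φ x ≠ x} ⊆ {x : Cylinder | (x.2 : ℝ) ∈ Ioo (-1 : ℝ) 1}

end Cylinder

namespace Cylinder

open Filter Topology

/-! ### Smoothness of integrals depending on parameters -/

section ParametricIntegral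

/-! An area-preserving map carrying straight circles onto the given curves can be written down by
integration, with no Moser flow. The diffeotopy serves only to give a lift `F` of its end to the
strip that has degree one and keeps each boundary line (`IsDiffeotopy.exists_stripDiffeo`).

First `F` is changed near the boundary, away from the interior curves, into a map `G` whose height
there is `cubic y` (`StripDiffeo.exists_straightened`). The height is interpolated between `(F p).2`
and `cubic y`. Because `cubic` is critical at the end points, `cubic y` lies nearer to the boundary
than the height of `F p`, and the derivative of the cutoff then contributes with a favourable sign:
no quantitative control of `F` is needed. The price is that `G` is a diffeomorphism of the open
strip only.

Next, `K = rearrange G` sends horizontal lines to horizontal lines and has the same Jacobian as `G`.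
The line at height `y` goes to height `area G y`, whose derivative is `fiberMass G y` by Green's
formula (`Straightened.hasDerivAt_area`), and along each line the density is integrated and
normalised to total mass one. The Jacobian is therefore density / mass * mass
(`Straightened.jac_fderiv_rearrange`). In the collars `K = G`, since there `G` already preserves the
horizontal foliation (`Straightened.rearrange_eq`).

Hence `Φ = G ∘ K⁻¹` has Jacobian one, is the identity near the boundary, and extends over it by the
identity. It takes the line at height `area G y` to the image under `G` of the line at height `y`,
which for the chosen interior heights is the image under `F`. Curves on the boundary are already
straight. -/

theorem continuous_slice {E : Type} [NormedAddCommGroup E] {F : Type} [NormedAddCommGroup F] {U : Set E} {g : ℝ × E → F}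
    (hg : ContinuousOn g (univ ×ˢ U)) {x : E} (hx : x ∈ U) : Continuous fun t : ℝ => g (t, x) := by
  rw [← continuousOn_univ]
  exact hg.comp (by fun_prop) fun t _ => ⟨mem_univ _, hx⟩

variable {E : Type} [NormedAddCommGroup E] [NormedSpace ℝ E] [ProperSpace E]

/-- Differentiation under the integral sign for a `C¹` integrand. -/
theorem hasFDerivAt_intervalIntegral {F : Type} [NormedAddCommGroup F] [NormedSpace ℝ F]
    {U : Set E} (hU : IsOpen U) {g : ℝ × E → F} (hg : ContDiffOn ℝ 1 g (univ ×ˢ U)) {x : E}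
    (hx : x ∈ U) :
    HasFDerivAt (fun x => ∫ t in (0 : ℝ)..1, g (t, x))
      (∫ t in (0 : ℝ)..1, (fderiv ℝ g (t, x)).comp (ContinuousLinearMap.inr ℝ ℝ E)) x := by
  have hUo : IsOpen ((univ : Set ℝ) ×ˢ U) := isOpen_univ.prod hU
  have hc : ContinuousOn (fun p => (fderiv ℝ g p).comp (ContinuousLinearMap.inr ℝ ℝ E))
      (univ ×ˢ U) :=
    (hg.continuousOn_fderiv_of_isOpen hUo le_rfl).clm_comp continuousOn_const
  obtain ⟨r, hr, hrU⟩ := Metric.nhds_basis_closedBall.mem_iff.1 (hU.mem_nhds hx)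
  have hK : IsCompact (Icc (0 : ℝ) 1 ×ˢ Metric.closedBall x r) :=
    isCompact_Icc.prod (isCompact_closedBall x r)
  obtain ⟨C, hC⟩ := hK.exists_bound_of_continuousOn
    (hc.mono (prod_mono (subset_univ _) hrU))
  have hd : ∀ t : ℝ, ∀ y ∈ U, HasFDerivAt (fun y => g (t, y))
      ((fderiv ℝ g (t, y)).comp (ContinuousLinearMap.inr ℝ ℝ E)) y := by
    intro t y hy
    have h1 : HasFDerivAt g (fderiv ℝ g (t, y)) (t, y) :=
      ((hg.differentiableOn one_ne_zero).differentiableAt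
        (hUo.mem_nhds ⟨mem_univ _, hy⟩)).hasFDerivAt
    exact h1.comp y (hasFDerivAt_prodMk_right t y)
  refine intervalIntegral.hasFDerivAt_integral_of_dominated_of_fderiv_le
    (F' := fun y t => (fderiv ℝ g (t, y)).comp (ContinuousLinearMap.inr ℝ ℝ E))
    (bound := fun _ => C) (Metric.closedBall_mem_nhds x hr) ?_ ?_ ?_ ?_ ?_ ?_
  · filter_upwards [hU.mem_nhds hx] with y hy
    exact (continuous_slice hg.continuousOn hy).aestronglyMeasurable
  · exact (continuous_slice hg.continuousOn hx).intervalIntegrable _ _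
  · exact (continuous_slice hc hx).aestronglyMeasurable
  · refine Eventually.of_forall fun t ht y hy => hC (t, y) ⟨?_, hy⟩
    rw [uIoc_of_le zero_le_one] at ht
    exact ⟨ht.1.le, ht.2⟩
  · exact intervalIntegrable_const
  · exact Eventually.of_forall fun t _ y hy => hd t y (hrU hy)

/-- Induction on the order of differentiability. The codomain is quantified inside the induction
because the derivative of the integral is again a parametric integral, with values in a space of
linear maps. -/
theorem contDiffOn_intervalIntegral_nat {U : Set E} (hU : IsOpen U) (n : ℕ) :
    ∀ {F : Type} [NormedAddCommGroup F] [NormedSpace ℝ F] {g : ℝ × E → F},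
      ContDiffOn ℝ n g (univ ×ˢ U) →
        ContDiffOn ℝ n (fun x => ∫ t in (0 : ℝ)..1, g (t, x)) U := by
  have hUo : IsOpen ((univ : Set ℝ) ×ˢ U) := isOpen_univ.prod hU
  induction n with
  | zero =>
    intro F _ _ g hg
    simp only [Nat.cast_zero, contDiffOn_zero] at hg ⊢
    intro x hx
    refine ContinuousAt.continuousWithinAt ?_
    obtain ⟨r, hr, hrU⟩ := Metric.nhds_basis_closedBall.mem_iff.1 (hU.mem_nhds hx)
    obtain ⟨C, hC⟩ := (isCompact_Icc.prod (isCompact_closedBall x r)).exists_bound_of_continuousOn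
      (hg.mono (prod_mono (subset_univ (Icc (0 : ℝ) 1)) hrU))
    refine intervalIntegral.continuousAt_of_dominated_interval (bound := fun _ => C) ?_ ?_
      intervalIntegrable_const ?_
    · filter_upwards [hU.mem_nhds hx] with y hy
      exact (continuous_slice hg hy).aestronglyMeasurable
    · filter_upwards [Metric.closedBall_mem_nhds x hr] with y hy
      refine Eventually.of_forall fun t ht => hC (t, y) ⟨?_, hy⟩
      rw [uIoc_of_le zero_le_one] at ht
      exact ⟨ht.1.le, ht.2⟩
    · refine Eventually.of_forall fun t _ => ?_
      have : ContinuousAt g (t, x) := hg.continuousAt (hUo.mem_nhds ⟨mem_univ _, hx⟩)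
      exact ContinuousAt.comp (f := fun y => (t, y)) this (by fun_prop)
  | succ n ih =>
    intro F _ _ g hg
    have h1 : ContDiffOn ℝ 1 g (univ ×ˢ U) := hg.of_le (by
      push_cast
      exact le_add_self)
    have hd := fun x hx => hasFDerivAt_intervalIntegral hU h1 (x := x) hx
    push_cast at hg ⊢
    rw [contDiffOn_succ_iff_fderiv_of_isOpen hU]
    refine ⟨fun x hx => (hd x hx).differentiableAt.differentiableWithinAt, by simp, ?_⟩
    refine (ih (g := fun p => (fderiv ℝ g p).comp (ContinuousLinearMap.inr ℝ ℝ E)) ?_).congr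
      fun x hx => (hd x hx).fderiv
    rw [contDiffOn_succ_iff_fderiv_of_isOpen hUo] at hg
    exact hg.2.2.clm_comp contDiffOn_const

theorem contDiffOn_intervalIntegral {F : Type} [NormedAddCommGroup F] [NormedSpace ℝ F]
    {U : Set E} (hU : IsOpen U) {g : ℝ × E → F} (hg : ContDiffOn ℝ ∞ g (univ ×ˢ U)) :
    ContDiffOn ℝ ∞ (fun x => ∫ t in (0 : ℝ)..1, g (t, x)) U :=
  contDiffOn_infty.2 fun n => contDiffOn_intervalIntegral_nat hU n (contDiffOn_infty.1 hg n)

end ParametricIntegral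

/-! ### Jacobians and the inverse function theorem in the plane -/

section Jacobian

/-- The Jacobian determinant of a linear self-map of the plane. -/
def jac (L : ℝ × ℝ →L[ℝ] ℝ × ℝ) : ℝ :=
  (L (1, 0)).1 * (L (0, 1)).2 - (L (1, 0)).2 * (L (0, 1)).1

theorem map_eq_basis {V : Type*} [AddCommGroup V] [Module ℝ V] [TopologicalSpace V]
    (L : ℝ × ℝ →L[ℝ] V) (u : ℝ × ℝ) : L u = u.1 • L (1, 0) + u.2 • L (0, 1) := by
  rw [← map_smul, ← map_smul, ← map_add]
  simp

/-- In dimension two symplectic means Jacobian one. Multiplicativity of `jac` and injectivity when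
`jac L ≠ 0` are also read off from this identity. -/
theorem omega_map (L : ℝ × ℝ →L[ℝ] ℝ × ℝ) (u v : ℝ × ℝ) :
    Omega (L u) (L v) = jac L * Omega u v := by
  rw [map_eq_basis L u, map_eq_basis L v]
  simp only [Omega, jac, Prod.fst_add, Prod.snd_add, Prod.smul_fst, Prod.smul_snd, smul_eq_mul]
  ring

theorem jac_comp (L M : ℝ × ℝ →L[ℝ] ℝ × ℝ) : jac (L.comp M) = jac L * jac M := by
  have h := omega_map L (M (1, 0)) (M (0, 1))
  simp only [Omega] at h
  simp only [jac, ContinuousLinearMap.comp_apply] at h ⊢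
  linarith

@[simp] theorem jac_id : jac (ContinuousLinearMap.id ℝ (ℝ × ℝ)) = 1 := by simp [jac]

theorem exists_equiv_of_jac_ne_zero {L : ℝ × ℝ →L[ℝ] ℝ × ℝ} (h : jac L ≠ 0) :
    ∃ e : (ℝ × ℝ) ≃L[ℝ] ℝ × ℝ, (e : ℝ × ℝ →L[ℝ] ℝ × ℝ) = L := by
  have hi : Function.Injective L.toLinearMap := by
    rw [injective_iff_map_eq_zero]
    intro u hu
    have h1 := omega_map L u (1, 0)
    have h2 := omega_map L u (0, 1)
    have hu' : L u = 0 := hu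
    rw [hu'] at h1 h2
    simp only [Omega, Prod.fst_zero, Prod.snd_zero] at h1 h2
    have h3 : u.2 = 0 := by
      have : jac L * u.2 = 0 := by linarith
      exact (mul_eq_zero.1 this).resolve_left h
    have h4 : u.1 = 0 := by
      have : jac L * u.1 = 0 := by linarith
      exact (mul_eq_zero.1 this).resolve_left h
    exact Prod.ext h4 h3
  refine ⟨(LinearEquiv.ofInjectiveEndo L.toLinearMap hi).toContinuousLinearEquiv, ?_⟩
  ext <;> rfl

theorem contDiff_jac : ContDiff ℝ ∞ jac := by
  unfold jac
  fun_prop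

/-- The inverse of a smooth injective map between open sets with non-zero Jacobian is smooth. -/
theorem contDiffAt_leftInverse {H H' : ℝ × ℝ → ℝ × ℝ} {U : Set (ℝ × ℝ)} (hU : IsOpen U)
    (hH : ContDiffOn ℝ ∞ H U) (hH' : ∀ p ∈ U, H' (H p) = p) {p : ℝ × ℝ} (hp : p ∈ U)
    (hj : jac (fderiv ℝ H p) ≠ 0) : ContDiffAt ℝ ∞ H' (H p) := by
  obtain ⟨e, he⟩ := exists_equiv_of_jac_ne_zero hj
  have hc : ContDiffAt ℝ ∞ H p := hH.contDiffAt (hU.mem_nhds hp)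
  have hd : HasFDerivAt H (e : ℝ × ℝ →L[ℝ] ℝ × ℝ) p := by
    rw [he]
    exact (hc.differentiableAt (by simp)).hasFDerivAt
  have hs : HasStrictFDerivAt H (e : ℝ × ℝ →L[ℝ] ℝ × ℝ) p := hc.hasStrictFDerivAt' hd (by simp)
  refine (hc.to_localInverse hd (by simp)).congr_of_eventuallyEq ?_
  have hl := hs.eventually_right_inverse
  have hcont := hs.localInverse_continuousAt
  have hmem : ∀ᶠ q in 𝓝 (H p), hs.localInverse H e p q ∈ U := by
    refine hcont.eventually_mem ?_
    rw [hs.localInverse_apply_image]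
    exact hU.mem_nhds hp
  filter_upwards [hl, hmem] with q hq hqU
  have := hH' _ hqU
  rw [hq] at this
  exact this

theorem map_nhds_of_jac_ne_zero {H : ℝ × ℝ → ℝ × ℝ} {p : ℝ × ℝ} (hc : ContDiffAt ℝ ∞ H p)
    (hj : jac (fderiv ℝ H p) ≠ 0) : map H (𝓝 p) = 𝓝 (H p) := by
  obtain ⟨e, he⟩ := exists_equiv_of_jac_ne_zero hj
  have hd : HasFDerivAt H (e : ℝ × ℝ →L[ℝ] ℝ × ℝ) p := by
    rw [he]
    exact (hc.differentiableAt (by simp)).hasFDerivAt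
  exact (hc.hasStrictFDerivAt' hd (by simp)).map_nhds_eq_of_equiv

end Jacobian

/-! ### The strip and its equivariant diffeomorphisms -/

/-- The open strip `ℝ × (-1, 1)`. -/
def openStrip : Set (ℝ × ℝ) := univ ×ˢ Ioo (-1 : ℝ) 1

theorem mem_strip {p : ℝ × ℝ} : p ∈ strip ↔ -1 ≤ p.2 ∧ p.2 ≤ 1 := by simp [strip]

theorem mem_openStrip {p : ℝ × ℝ} : p ∈ openStrip ↔ -1 < p.2 ∧ p.2 < 1 := by simp [openStrip]

theorem isOpen_openStrip : IsOpen openStrip := isOpen_univ.prod isOpen_Ioo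

theorem openStrip_subset : openStrip ⊆ strip := prod_mono le_rfl Ioo_subset_Icc_self

theorem interior_strip : interior strip = openStrip := by
  rw [strip, interior_prod_eq, interior_univ, interior_Icc, openStrip]

theorem strip_mem_nhds {p : ℝ × ℝ} (hp : p ∈ openStrip) : strip ∈ 𝓝 p :=
  mem_of_superset (isOpen_openStrip.mem_nhds hp) openStrip_subset

theorem convex_strip : Convex ℝ strip := convex_univ.prod (convex_Icc _ _)

theorem uniqueDiffOn_strip : UniqueDiffOn ℝ strip :=
  uniqueDiffOn_univ.prod (uniqueDiffOn_Icc (by norm_num))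

theorem isPreconnected_openStrip : IsPreconnected openStrip :=
  (convex_univ.prod (convex_Ioo _ _)).isPreconnected

theorem add_mem_strip {p : ℝ × ℝ} (hp : p ∈ strip) (c : ℝ) : p + (c, 0) ∈ strip := by
  rw [mem_strip] at hp ⊢
  simpa using hp

/-- Controls every discrete ambiguity below: the deck translation between two lifts, the degree of a
lift, and the choice of boundary line. -/
theorem eq_of_isPreconnected_of_int {X : Type*} [TopologicalSpace X] {S : Set X}
    (hS : IsPreconnected S) {g : X → ℝ} (hg : ContinuousOn g S)
    (hint : ∀ x ∈ S, ∃ n : ℤ, g x = n) {x y : X} (hx : x ∈ S) (hy : y ∈ S) : g x = g y := by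
  have : DiscreteTopology (range ((↑) : ℤ → ℝ)) :=
    Int.isClosedEmbedding_coe_real.isEmbedding.toHomeomorph.symm.isEmbedding.discreteTopology
  exact hS.constant_of_mapsTo (T := range ((↑) : ℤ → ℝ)) ⟨this⟩ hg
    (fun z hz => (hint z hz).imp fun n hn => hn.symm) hx hy

theorem exists_int_of_coe_eq {a b : ℝ} (h : (a : AddCircle (1 : ℝ)) = b) :
    ∃ n : ℤ, a - b = n := by
  rw [← sub_eq_zero, ← AddCircle.coe_sub, AddCircle.coe_eq_zero_iff] at h
  obtain ⟨n, hn⟩ := h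
  exact ⟨n, by simpa using hn.symm⟩

theorem coe_add_intCast (a : ℝ) (n : ℤ) : ((a + n : ℝ) : AddCircle (1 : ℝ)) = a := by
  rw [AddCircle.coe_add, add_eq_left, AddCircle.coe_eq_zero_iff]
  exact ⟨n, by simp⟩

/-- `F` and `E` are mutually inverse smooth self-maps of the strip, commuting with the deck
transformation `(θ, y) ↦ (θ + 1, y)`. -/
structure StripDiffeo (F E : ℝ × ℝ → ℝ × ℝ) : Prop where
  smooth : ContDiffOn ℝ ∞ F strip
  smooth_inv : ContDiffOn ℝ ∞ E strip
  mapsTo : MapsTo F strip strip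
  mapsTo_inv : MapsTo E strip strip
  left_inv : ∀ p ∈ strip, E (F p) = p
  right_inv : ∀ p ∈ strip, F (E p) = p
  add_one : ∀ p ∈ strip, F (p + (1, 0)) = F p + (1, 0)

namespace StripDiffeo

variable {F E : ℝ × ℝ → ℝ × ℝ}

theorem symm (h : StripDiffeo F E) : StripDiffeo E F where
  smooth := h.smooth_inv
  smooth_inv := h.smooth
  mapsTo := h.mapsTo_inv
  mapsTo_inv := h.mapsTo
  left_inv := h.right_inv
  right_inv := h.left_inv
  add_one := fun p hp => by
    have := h.add_one _ (h.mapsTo_inv hp)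
    rw [h.right_inv p hp] at this
    rw [← this, h.left_inv _ (add_mem_strip (h.mapsTo_inv hp) 1)]

/-- The chain rule for `E ∘ F = id`. It reaches the boundary because derivatives within the strip
are unique there. -/
theorem jac_mul_jac (h : StripDiffeo F E) {p : ℝ × ℝ} (hp : p ∈ strip) :
    jac (fderivWithin ℝ E strip (F p)) * jac (fderivWithin ℝ F strip p) = 1 := by
  have h1 : HasFDerivWithinAt F (fderivWithin ℝ F strip p) strip p :=
    (h.smooth.differentiableOn (by simp) p hp).hasFDerivWithinAt
  have h2 : HasFDerivWithinAt E (fderivWithin ℝ E strip (F p)) strip (F p) :=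
    (h.smooth_inv.differentiableOn (by simp) _ (h.mapsTo hp)).hasFDerivWithinAt
  have h3 := h2.comp p h1 h.mapsTo
  have h4 : HasFDerivWithinAt (E ∘ F) (ContinuousLinearMap.id ℝ (ℝ × ℝ)) strip p :=
    (hasFDerivWithinAt_id p strip).congr (fun q hq => h.left_inv q hq) (h.left_inv p hp)
  have h5 := (uniqueDiffOn_strip p hp).eq h3 h4
  rw [← jac_comp, h5, jac_id]

theorem jac_fderiv_ne_zero (h : StripDiffeo F E) {p : ℝ × ℝ} (hp : p ∈ openStrip) :
    jac (fderiv ℝ F p) ≠ 0 := by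
  have h1 := h.jac_mul_jac (openStrip_subset hp)
  rw [fderivWithin_of_mem_nhds (strip_mem_nhds hp)] at h1
  exact right_ne_zero_of_mul_eq_one h1

theorem contDiffAt (h : StripDiffeo F E) {p : ℝ × ℝ} (hp : p ∈ openStrip) :
    ContDiffAt ℝ ∞ F p := h.smooth.contDiffAt (strip_mem_nhds hp)

/-- By the inverse function theorem the image of a neighbourhood of an interior point is a
neighbourhood of its image, and it stays in the strip. -/
theorem mapsTo_openStrip (h : StripDiffeo F E) : MapsTo F openStrip openStrip := by
  intro p hp
  rw [← interior_strip, mem_interior_iff_mem_nhds, ← map_nhds_of_jac_ne_zero (h.contDiffAt hp)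
    (h.jac_fderiv_ne_zero hp)]
  exact mem_map.2 (mem_of_superset (strip_mem_nhds hp) h.mapsTo)

/-- The boundary of the strip is preserved. -/
theorem boundary (h : StripDiffeo F E) {p : ℝ × ℝ} (hp : p.2 = -1 ∨ p.2 = 1) :
    (F p).2 = -1 ∨ (F p).2 = 1 := by
  have hps : p ∈ strip := by
    rw [mem_strip]
    rcases hp with hp | hp <;> rw [hp] <;> norm_num
  have h1 := mem_strip.1 (h.mapsTo hps)
  by_contra! hc
  have h2 : F p ∈ openStrip :=
    mem_openStrip.2 ⟨lt_of_le_of_ne h1.1 hc.1.symm, lt_of_le_of_ne h1.2 hc.2⟩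
  have h3 := h.symm.mapsTo_openStrip h2
  rw [h.left_inv p hps, mem_openStrip] at h3
  rcases hp with hp | hp <;> rw [hp] at h3 <;> linarith [h3.1, h3.2]

end StripDiffeo

theorem add_int_of_add_one {F : ℝ × ℝ → ℝ × ℝ}
    (h : ∀ p ∈ strip, F (p + (1, 0)) = F p + (1, 0)) {p : ℝ × ℝ} (hp : p ∈ strip) (n : ℤ) :
    F (p + ((n : ℝ), 0)) = F p + ((n : ℝ), 0) := by
  induction n with
  | zero => simp [show ((0 : ℝ), (0 : ℝ)) = 0 from rfl]
  | succ n ih =>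
    have e : (((n + 1 : ℤ) : ℝ), (0 : ℝ)) = (((n : ℤ) : ℝ), 0) + (1, 0) := by simp
    rw [e, ← add_assoc, h _ (add_mem_strip hp _), ih, add_assoc]
  | pred n ih =>
    have e : (((-n : ℤ) : ℝ), (0 : ℝ)) = (((-n - 1 : ℤ) : ℝ), 0) + (1, 0) := by simp
    rw [e, ← add_assoc, h _ (add_mem_strip hp _), ← add_assoc] at ih
    exact add_right_cancel ih

/-! ### Lifting the end of a diffeotopy to the strip -/

section Lift

variable {F : ℝ × ℝ → ℝ × ℝ}

theorem IsLift.mapsTo {f : Cylinder → Cylinder} (h : IsLift F f) : MapsTo F strip strip := by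
  rintro ⟨θ, y⟩ hp
  have := (h θ ⟨y, hp.2⟩).2
  rw [mem_strip, this]
  exact (f _).2.2

/-- A point of the cylinder below a given point of the strip. -/
def proj (p : ℝ × ℝ) (hp : p ∈ strip) : Cylinder := (p.1, ⟨p.2, hp.2⟩)

theorem IsLift.proj_eq {f : Cylinder → Cylinder} (h : IsLift F f) {p : ℝ × ℝ} (hp : p ∈ strip) :
    proj (F p) (h.mapsTo hp) = f (proj p hp) :=
  Prod.ext (h p.1 ⟨p.2, hp.2⟩).1 (Subtype.ext (h p.1 ⟨p.2, hp.2⟩).2)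

theorem exists_int_of_proj_eq {p q : ℝ × ℝ} {hp : p ∈ strip} {hq : q ∈ strip}
    (h : proj p hp = proj q hq) : ∃ n : ℤ, p = q + ((n : ℝ), 0) := by
  obtain ⟨n, hn⟩ := exists_int_of_coe_eq (congrArg Prod.fst h)
  refine ⟨n, Prod.ext ?_ ?_⟩
  · simp only [Prod.fst_add]
    linarith
  · have := congrArg (fun x : Cylinder => (x.2 : ℝ)) h
    simpa [proj] using this

theorem proj_add_int {p : ℝ × ℝ} (hp : p ∈ strip) (n : ℤ) :
    proj (p + ((n : ℝ), 0)) (add_mem_strip hp n) = proj p hp :=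
  Prod.ext (coe_add_intCast p.1 n) (Subtype.ext (by simp [proj]))

/-- A smooth lift of degree one of a diffeomorphism is a diffeomorphism of the strip. -/
theorem exists_stripDiffeo {f : Cylinder ≃ Cylinder} (hF : ContDiffOn ℝ ∞ F strip)
    (hl : IsLift F f) (h1 : ∀ p ∈ strip, F (p + (1, 0)) = F p + (1, 0))
    (hf : IsSmooth f.symm) : ∃ E, StripDiffeo F E := by
  obtain ⟨E₀, hE₀, hl₀⟩ := hf
  -- An arbitrary lift of the inverse inverts `F` up to a deck translation, which is constant by
  -- connectedness; subtracting it gives the true inverse.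
  have hint : ∀ p ∈ strip, ∃ n : ℤ, E₀ (F p) = p + ((n : ℝ), 0) := by
    intro p hp
    refine exists_int_of_proj_eq (hp := hl₀.mapsTo (hl.mapsTo hp)) (hq := hp) ?_
    rw [hl₀.proj_eq (hl.mapsTo hp), hl.proj_eq hp, Equiv.symm_apply_apply]
  have h0 : ((0, 0) : ℝ × ℝ) ∈ strip := mem_strip.2 (by norm_num)
  obtain ⟨n, hn⟩ := hint _ h0
  have hEF : ∀ p ∈ strip, E₀ (F p) = p + ((n : ℝ), 0) := by
    intro p hp
    obtain ⟨m, hm⟩ := hint p hp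
    have hc : ContinuousOn (fun p => (E₀ (F p)).1 - p.1) strip :=
      (continuous_fst.comp_continuousOn (hE₀.continuousOn.comp hF.continuousOn hl.mapsTo)).sub
        continuousOn_fst
    have := eq_of_isPreconnected_of_int convex_strip.isPreconnected hc (fun q hq => by
      obtain ⟨k, hk⟩ := hint q hq
      exact ⟨k, by simp [hk]⟩) hp h0
    rw [hm, hn] at this
    simp only [Prod.fst_add, add_sub_cancel_left] at this
    rw [hm, this]
  have hsurj : ∀ q ∈ strip, ∃ p ∈ strip, F p = q := by
    intro q hq
    obtain ⟨k, hk⟩ := exists_int_of_proj_eq (p := F (E₀ q)) (q := q)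
      (hp := hl.mapsTo (hl₀.mapsTo hq)) (hq := hq) (by
        rw [hl.proj_eq (hl₀.mapsTo hq), hl₀.proj_eq hq, Equiv.apply_symm_apply])
    refine ⟨E₀ q + (((-k : ℤ) : ℝ), 0), add_mem_strip (hl₀.mapsTo hq) _, ?_⟩
    rw [add_int_of_add_one h1 (hl₀.mapsTo hq), hk, add_assoc]
    simp
  have hleft : ∀ p ∈ strip, E₀ (F p) - ((n : ℝ), 0) = p := fun p hp => by
    rw [hEF p hp, add_sub_cancel_right]
  refine ⟨fun q => E₀ q - ((n : ℝ), 0), hF, hE₀.sub contDiffOn_const, hl.mapsTo, ?_, hleft, ?_, h1⟩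
  · intro q hq
    obtain ⟨p, hp, rfl⟩ := hsurj q hq
    simp only
    rwa [hleft p hp]
  · intro q hq
    obtain ⟨p, hp, rfl⟩ := hsurj q hq
    rw [hleft p hp]

end Lift

/-- The end of a diffeotopy lifts to a diffeomorphism of the strip that commutes with the deck
transformations and preserves each of the boundary lines. -/
theorem IsDiffeotopy.exists_stripDiffeo {f : I → Cylinder ≃ Cylinder} (hf : IsDiffeotopy f) :
    ∃ F E, IsLift F (f 1) ∧ StripDiffeo F E ∧ (∀ x, (F (x, -1)).2 = -1) ∧
      ∀ x, (F (x, 1)).2 = 1 := by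
  obtain ⟨hd, h0, F, hF, hl⟩ := hf
  have hmem : ∀ {t : ℝ} {p : ℝ × ℝ}, t ∈ Icc (0 : ℝ) 1 → p ∈ strip →
      (t, p) ∈ Icc (0 : ℝ) 1 ×ˢ strip := fun ht hp => ⟨ht, hp⟩
  have hpre : IsPreconnected (Icc (0 : ℝ) 1 ×ˢ strip) :=
    ((convex_Icc _ _).prod convex_strip).isPreconnected
  have hid : ∀ p ∈ strip, ∃ n : ℤ, F (0, p) = p + ((n : ℝ), 0) := by
    intro p hp
    exact exists_int_of_proj_eq (hq := hp)
      (((hl 0).proj_eq hp).trans (congrArg (fun e : Cylinder ≃ Cylinder => e (proj p hp)) h0))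
  have hshift : ∀ t ∈ Icc (0 : ℝ) 1, ∀ p ∈ strip, ∃ n : ℤ,
      F (t, p + (1, 0)) = F (t, p) + ((n : ℝ), 0) := by
    intro t ht p hp
    have h := (hl ⟨t, ht⟩).proj_eq hp
    have hp1 := add_mem_strip hp ((1 : ℤ) : ℝ)
    have h' := (hl ⟨t, ht⟩).proj_eq hp1
    rw [proj_add_int hp 1, ← h] at h'
    rw [Int.cast_one] at h'
    exact exists_int_of_proj_eq h'
  -- The degree is an integer depending continuously on time and point. It is one at time `0`, where
  -- `F` is a deck translation.
  have hadd : ∀ t ∈ Icc (0 : ℝ) 1, ∀ p ∈ strip, F (t, p + (1, 0)) = F (t, p) + (1, 0) := by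
    have hc : ContinuousOn (fun q : ℝ × (ℝ × ℝ) => (F (q.1, q.2 + (1, 0))).1 - (F q).1)
        (Icc (0 : ℝ) 1 ×ˢ strip) := by
      refine ContinuousOn.sub ?_ (continuous_fst.comp_continuousOn hF.continuousOn)
      refine continuous_fst.comp_continuousOn (hF.continuousOn.comp (by fun_prop) ?_)
      exact fun q hq => ⟨hq.1, add_mem_strip hq.2 1⟩
    intro t ht p hp
    have hp1 := add_mem_strip hp 1
    have h00 : (0 : ℝ) ∈ Icc (0 : ℝ) 1 := by simp
    have h1 := eq_of_isPreconnected_of_int hpre hc (fun q hq => by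
      obtain ⟨k, hk⟩ := hshift q.1 hq.1 q.2 hq.2
      exact ⟨k, by simp [hk]⟩) (hmem ht hp) (hmem h00 hp)
    have hc0 : ContinuousOn (fun q : ℝ × ℝ => (F (0, q)).1 - q.1) strip :=
      (continuous_fst.comp_continuousOn (hF.continuousOn.comp (by fun_prop)
        fun q hq => hmem h00 hq)).sub continuousOn_fst
    have h2 := eq_of_isPreconnected_of_int convex_strip.isPreconnected hc0 (fun q hq => by
      obtain ⟨k, hk⟩ := hid q hq
      exact ⟨k, by simp [hk]⟩) hp1 hp
    obtain ⟨n, hn⟩ := hshift t ht p hp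
    rw [hn]
    simp only [hn, Prod.fst_add, add_sub_cancel_left] at h1 h2
    rw [h1]
    congr 2
    linarith
  have hS : ∀ t ∈ Icc (0 : ℝ) 1, ∃ E, StripDiffeo (fun p => F (t, p)) E := fun t ht =>
    Cylinder.exists_stripDiffeo (hF.comp (by fun_prop) fun q hq => hmem ht hq) (hl ⟨t, ht⟩)
      (hadd t ht) (hd ⟨t, ht⟩).2
  have hb : ∀ (x y : ℝ), y = -1 ∨ y = 1 → (F (1, (x, y))).2 = y := by
    intro x y hy
    have hp : (x, y) ∈ strip := by
      rw [mem_strip]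
      rcases hy with rfl | rfl <;> norm_num
    -- The affine change turns the two possible heights `-1` and `1` into the integers `0` and `1`,
    -- so a boundary point cannot switch lines during the diffeotopy.
    have hc : ContinuousOn (fun t : ℝ => ((F (t, (x, y))).2 + 1) / 2) (Icc 0 1) := by
      have : ContinuousOn (fun t : ℝ => F (t, (x, y))) (Icc 0 1) :=
        hF.continuousOn.comp (by fun_prop) fun t ht => hmem ht hp
      exact ((continuous_snd.comp_continuousOn this).add continuousOn_const).div_const 2
    have h1 := eq_of_isPreconnected_of_int isPreconnected_Icc hc (fun t ht => by
      obtain ⟨E, hE⟩ := hS t ht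
      rcases hE.boundary (p := (x, y)) hy with h | h
      · exact ⟨0, by simp only [h]; norm_num⟩
      · exact ⟨1, by simp only [h]; norm_num⟩) (x := 1) (y := 0) (by simp) (by simp)
    obtain ⟨n, hn⟩ := hid _ hp
    rw [hn] at h1
    simp only [Prod.snd_add, add_zero] at h1
    linarith
  obtain ⟨E, hE⟩ := hS 1 (by simp)
  exact ⟨_, E, hl 1, hE, fun x => hb x _ (Or.inl rfl), fun x => hb x _ (Or.inr rfl)⟩

theorem hasDerivAt_slice_snd {V : Type*} [NormedAddCommGroup V] [NormedSpace ℝ V]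
    {H : ℝ × ℝ → V} {x z : ℝ} (hH : DifferentiableAt ℝ H (x, z)) :
    HasDerivAt (fun z => H (x, z)) (fderiv ℝ H (x, z) (0, 1)) z :=
  hH.hasFDerivAt.comp_hasDerivAt z ((hasDerivAt_const z x).prodMk (hasDerivAt_id z))

theorem hasDerivAt_slice_fst {V : Type*} [NormedAddCommGroup V] [NormedSpace ℝ V]
    {H : ℝ × ℝ → V} {x z : ℝ} (hH : DifferentiableAt ℝ H (x, z)) :
    HasDerivAt (fun x => H (x, z)) (fderiv ℝ H (x, z) (1, 0)) x :=
  HasFDerivAt.comp_hasDerivAt (f := fun x => (x, z)) x hH.hasFDerivAt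
    ((hasDerivAt_id x).prodMk (hasDerivAt_const x z))

/-! ### Straightening a diffeomorphism near the boundary -/

/-- An odd increasing bijection of `[-1, 1]`, critical at the end points. -/
noncomputable def cubic (y : ℝ) : ℝ := (3 * y - y ^ 3) / 2

theorem hasDerivAt_cubic (y : ℝ) : HasDerivAt cubic ((3 - 3 * y ^ 2) / 2) y := by
  have := (((hasDerivAt_id y).const_mul 3).sub ((hasDerivAt_id y).pow 3)).div_const 2
  exact this.congr_deriv (by simp)

theorem contDiff_cubic : ContDiff ℝ ∞ cubic := by
  unfold cubic
  fun_prop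

/-- A bump function of the height, decreasing in `|y|`. -/
theorem exists_cutoff {b : ℝ} (hb : 0 < b) (hb1 : b < 1) :
    ∃ χ : ℝ → ℝ, ContDiff ℝ ∞ χ ∧ (∀ y, 0 ≤ χ y) ∧ (∀ y, χ y ≤ 1) ∧
      (∀ y, |y| ≤ 1 - b → χ y = 1) ∧ (∀ y, 1 - b / 2 ≤ |y| → χ y = 0) ∧
      ∀ y, deriv χ y * y ≤ 0 := by
  set c₀ := (1 - b) ^ 2
  set c₁ := (1 - b / 2) ^ 2
  have hc : 0 < c₁ - c₀ := by
    simp only [c₀, c₁]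
    nlinarith
  -- Working with `y ^ 2` makes the cutoff even and smooth at `0`.
  refine ⟨fun y => Real.smoothTransition ((c₁ - y ^ 2) / (c₁ - c₀)),
    Real.smoothTransition.contDiff.comp (by fun_prop), fun y => Real.smoothTransition.nonneg _,
    fun y => Real.smoothTransition.le_one _, fun y hy => ?_, fun y hy => ?_, fun y => ?_⟩
  · refine Real.smoothTransition.one_of_one_le ?_
    rw [one_le_div hc]
    have : y ^ 2 ≤ c₀ := by
      rw [← sq_abs]
      exact pow_le_pow_left₀ (abs_nonneg y) hy 2
    linarith
  · refine Real.smoothTransition.zero_of_nonpos (div_nonpos_of_nonpos_of_nonneg ?_ hc.le)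
    have : c₁ ≤ y ^ 2 := by
      rw [← sq_abs y]
      exact pow_le_pow_left₀ (by linarith) hy 2
    linarith
  · have h1 : HasDerivAt (fun y : ℝ => (c₁ - y ^ 2) / (c₁ - c₀)) (-(2 * y) / (c₁ - c₀)) y := by
      exact (((hasDerivAt_const y c₁).sub ((hasDerivAt_id y).pow 2)).div_const
        (c₁ - c₀)).congr_deriv (by simp)
    have h2 : DifferentiableAt ℝ Real.smoothTransition ((c₁ - y ^ 2) / (c₁ - c₀)) :=
      (Real.smoothTransition.contDiff (n := 1)).differentiable one_ne_zero _
    have h3 := (h2.hasDerivAt.comp y h1).deriv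
    rw [Function.comp_def] at h3
    rw [h3]
    have h4 : 0 ≤ deriv Real.smoothTransition ((c₁ - y ^ 2) / (c₁ - c₀)) :=
      Real.smoothTransition.monotone.deriv_nonneg
    have h5 : 0 ≤ y ^ 2 / (c₁ - c₀) := by positivity
    have : deriv Real.smoothTransition ((c₁ - y ^ 2) / (c₁ - c₀)) * (-(2 * y) / (c₁ - c₀)) * y
        = -2 * (deriv Real.smoothTransition ((c₁ - y ^ 2) / (c₁ - c₀)) *
          (y ^ 2 / (c₁ - c₀))) := by ring
    rw [this]
    nlinarith [mul_nonneg h4 h5]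

/-- `F` preserves each of the two boundary lines of the strip. -/
def FixesEnds (F : ℝ × ℝ → ℝ × ℝ) : Prop :=
  (∀ x, (F (x, -1)).2 = -1) ∧ ∀ x, (F (x, 1)).2 = 1

/-- The vertical derivative of the height of `E`. -/
noncomputable def heightDeriv (E : ℝ × ℝ → ℝ × ℝ) (p : ℝ × ℝ) : ℝ :=
  (fderivWithin ℝ E strip p (0, 1)).2

namespace StripDiffeo

variable {F E : ℝ × ℝ → ℝ × ℝ}

theorem fixesEnds_symm (h : StripDiffeo F E) (hF : FixesEnds F) : FixesEnds E := by
  have key : ∀ x y : ℝ, y = -1 ∨ y = 1 → (E (x, y)).2 = y := by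
    intro x y hy
    have hp : (x, y) ∈ strip := by
      rw [mem_strip]
      rcases hy with rfl | rfl <;> norm_num
    have h1 := h.right_inv _ hp
    have h2 : (F (E (x, y))).2 = y := by rw [h1]
    rcases h.symm.boundary (p := (x, y)) hy with h3 | h3
    · rw [← Prod.mk.eta (p := E (x, y)), h3, hF.1] at h2
      rw [h3, h2]
    · rw [← Prod.mk.eta (p := E (x, y)), h3, hF.2] at h2
      rw [h3, h2]
  exact ⟨fun x => key x _ (Or.inl rfl), fun x => key x _ (Or.inr rfl)⟩

theorem hasFDerivWithinAt_height (h : StripDiffeo F E) {p : ℝ × ℝ} (hp : p ∈ strip) :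
    HasFDerivWithinAt (fun q => (F q).2)
      ((ContinuousLinearMap.snd ℝ ℝ ℝ).comp (fderivWithin ℝ F strip p)) strip p :=
  (ContinuousLinearMap.snd ℝ ℝ ℝ).hasFDerivAt.comp_hasFDerivWithinAt p
    (h.smooth.differentiableOn (by simp) p hp).hasFDerivWithinAt

theorem hasDerivWithinAt_height (h : StripDiffeo F E) (x : ℝ) {z : ℝ} (hz : z ∈ Icc (-1 : ℝ) 1) :
    HasDerivWithinAt (fun z => (F (x, z)).2) (heightDeriv F (x, z)) (Icc (-1) 1) z :=
  (h.hasFDerivWithinAt_height (p := (x, z)) ⟨mem_univ _, hz⟩).comp_hasDerivWithinAt z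
    ((hasDerivWithinAt_const z _ x).prodMk (hasDerivWithinAt_id z _))
    fun _ hy => ⟨mem_univ _, hy⟩

theorem height_add_int (h : StripDiffeo F E) (x : ℝ) {z : ℝ} (hz : z ∈ Icc (-1 : ℝ) 1) (n : ℤ) :
    (F (x + n, z)).2 = (F (x, z)).2 := by
  have := add_int_of_add_one h.add_one (p := (x, z)) ⟨mem_univ _, hz⟩ n
  simp only [Prod.mk_add_mk, add_zero] at this
  rw [this]
  simp

theorem heightDeriv_add_int (h : StripDiffeo F E) (x : ℝ) {z : ℝ} (hz : z ∈ Icc (-1 : ℝ) 1)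
    (n : ℤ) : heightDeriv F (x + n, z) = heightDeriv F (x, z) :=
  (uniqueDiffOn_Icc (by norm_num) z hz).eq_deriv _ (h.hasDerivWithinAt_height (x + n) hz)
    ((h.hasDerivWithinAt_height x hz).congr (fun y hy => h.height_add_int x hy n)
      (h.height_add_int x hz n))

theorem continuousOn_heightDeriv (h : StripDiffeo F E) : ContinuousOn (heightDeriv F) strip :=
  continuous_snd.comp_continuousOn
    ((h.smooth.continuousOn_fderivWithin uniqueDiffOn_strip (by simp)).clm_apply
      continuousOn_const)

/-- The height is extremal on a boundary line, so its horizontal derivative vanishes and its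
vertical derivative is nonnegative; the latter cannot vanish because the Jacobian does not. -/
theorem heightDeriv_pos (h : StripDiffeo F E) (hF : FixesEnds F) {x z : ℝ}
    (hz : z = -1 ∨ z = 1) : 0 < heightDeriv F (x, z) := by
  have hp : (x, z) ∈ strip := by
    rw [mem_strip]
    rcases hz with rfl | rfl <;> norm_num
  have hd := h.hasFDerivWithinAt_height hp
  have hcone : ∀ v : ℝ × ℝ, (x, z) + v ∈ strip → v ∈ posTangentConeAt strip (x, z) := fun v hv =>
    mem_posTangentConeAt_of_segment_subset (convex_strip.segment_subset hp hv)
  have hj := right_ne_zero_of_mul_eq_one (h.jac_mul_jac hp)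
  have hc1 := hcone (1, 0) (add_mem_strip hp 1)
  have hc2 := hcone (-1, 0) (add_mem_strip hp (-1))
  have hneg : ((-1 : ℝ), (0 : ℝ)) = -(1, 0) := by simp
  have hneg' : ((0 : ℝ), (-1 : ℝ)) = -(0, 1) := by simp
  have key : (fderivWithin ℝ F strip (x, z) (1, 0)).2 = 0 ∧
      0 ≤ (fderivWithin ℝ F strip (x, z) (0, 1)).2 := by
    rcases hz with rfl | rfl
    · have hm : IsLocalMinOn (fun q => (F q).2) strip (x, -1) := by
        filter_upwards [self_mem_nhdsWithin] with q hq
        rw [hF.1]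
        exact (mem_strip.1 (h.mapsTo hq)).1
      have h1 := hm.hasFDerivWithinAt_nonneg hd hc1
      have h2 := hm.hasFDerivWithinAt_nonneg hd hc2
      have h3 := hm.hasFDerivWithinAt_nonneg hd (hcone (0, 1) (mem_strip.2 (by simp)))
      rw [hneg, map_neg] at h2
      simp only [ContinuousLinearMap.comp_apply, ContinuousLinearMap.coe_snd'] at h1 h2 h3
      exact ⟨by linarith, h3⟩
    · have hm : IsLocalMaxOn (fun q => (F q).2) strip (x, 1) := by
        filter_upwards [self_mem_nhdsWithin] with q hq
        rw [hF.2]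
        exact (mem_strip.1 (h.mapsTo hq)).2
      have h1 := hm.hasFDerivWithinAt_nonpos hd hc1
      have h2 := hm.hasFDerivWithinAt_nonpos hd hc2
      have h3 := hm.hasFDerivWithinAt_nonpos hd (hcone (0, -1) (mem_strip.2 (by simp)))
      rw [hneg, map_neg] at h2
      rw [hneg', map_neg] at h3
      simp only [ContinuousLinearMap.comp_apply, ContinuousLinearMap.coe_snd'] at h1 h2 h3
      exact ⟨by linarith, by linarith⟩
  refine lt_of_le_of_ne key.2 fun h0 => hj ?_
  rw [heightDeriv] at h0
  rw [jac, key.1, ← h0]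
  ring

/-- In a thin collar of the boundary the height of `E` increases along verticals, and the height
of `E`, flattened by `cubic`, is closer to the boundary than the height itself. -/
theorem exists_collar (h : StripDiffeo E F) (hE : FixesEnds E) {b₀ : ℝ} (hb₀ : 0 < b₀) :
    ∃ b, 0 < b ∧ b ≤ b₀ ∧ b < 1 ∧ ∀ p ∈ strip, 1 - b ≤ |(E p).2| →
      0 < heightDeriv E p ∧ 0 ≤ (E p).2 * (cubic (E p).2 - p.2) := by
  set K : Set (ℝ × ℝ) := Icc 0 1 ×ˢ Icc (-1) 1
  have hK : IsCompact K := isCompact_Icc.prod isCompact_Icc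
  have hKs : K ⊆ strip := prod_mono (subset_univ _) le_rfl
  have hfract : ∀ p ∈ strip, ∃ q ∈ K, q.2 = p.2 ∧ (E q).2 = (E p).2 ∧
      heightDeriv E q = heightDeriv E p := by
    rintro ⟨x, z⟩ hp
    refine ⟨(Int.fract x, z), ⟨⟨Int.fract_nonneg x, (Int.fract_lt_one x).le⟩, hp.2⟩, rfl, ?_, ?_⟩
    · have := h.height_add_int (Int.fract x) hp.2 ⌊x⌋
      rwa [Int.fract_add_floor, eq_comm] at this
    · have := h.heightDeriv_add_int (Int.fract x) hp.2 ⌊x⌋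
      rwa [Int.fract_add_floor, eq_comm] at this
  obtain ⟨C, hC⟩ := hK.exists_bound_of_continuousOn (h.continuousOn_heightDeriv.mono hKs)
  have hC' : ∀ p ∈ strip, ‖heightDeriv E p‖ ≤ max C 1 := by
    intro p hp
    obtain ⟨q, hq, -, -, h3⟩ := hfract p hp
    rw [← h3]
    exact (hC q hq).trans (le_max_left _ _)
  set C₁ := max C 1
  have hC₁ : 0 < C₁ := zero_lt_one.trans_le (le_max_right _ _)
  -- Over one period the bad set, where the vertical derivative is not positive, is compact and
  -- avoids the boundary. Its image therefore stays at a positive distance from the boundary.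
  obtain ⟨m, hm1, hm⟩ : ∃ m < 1, ∀ p ∈ K, heightDeriv E p ≤ 0 → |(E p).2| ≤ m := by
    have hQ : IsCompact (K ∩ heightDeriv E ⁻¹' Iic 0) :=
      hK.of_isClosed_subset ((h.continuousOn_heightDeriv.mono hKs).preimage_isClosed_of_isClosed
        hK.isClosed isClosed_Iic) inter_subset_left
    rcases (K ∩ heightDeriv E ⁻¹' Iic 0).eq_empty_or_nonempty with h0 | h0
    · refine ⟨0, zero_lt_one, fun p hp hp' => ?_⟩
      have : p ∈ K ∩ heightDeriv E ⁻¹' Iic 0 := ⟨hp, hp'⟩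
      rw [h0] at this
      exact this.elim
    · have hc : ContinuousOn (fun p => |(E p).2|) (K ∩ heightDeriv E ⁻¹' Iic 0) :=
        (continuous_snd.comp_continuousOn
          (h.smooth.continuousOn.mono (inter_subset_left.trans hKs))).abs
      obtain ⟨q, hq, hmax⟩ := hQ.exists_isMaxOn h0 hc
      refine ⟨_, ?_, fun p hp hp' => hmax ⟨hp, hp'⟩⟩
      have hq1 := mem_strip.1 (hKs hq.1)
      have hqo : q ∈ openStrip := by
        refine mem_openStrip.2 ⟨lt_of_le_of_ne hq1.1 fun he => ?_, lt_of_le_of_ne hq1.2 fun he => ?_⟩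
        · exact (h.heightDeriv_pos hE (x := q.1) (z := q.2) (Or.inl he.symm)).not_ge hq.2
        · exact (h.heightDeriv_pos hE (x := q.1) (z := q.2) (Or.inr he)).not_ge hq.2
      exact abs_lt.2 (mem_openStrip.1 (h.mapsTo_openStrip hqo))
  have hlip : ∀ x z z' : ℝ, z ∈ Icc (-1 : ℝ) 1 → z' ∈ Icc (-1 : ℝ) 1 →
      |(E (x, z)).2 - (E (x, z')).2| ≤ C₁ * |z - z'| := fun x z z' hz hz' =>
    (convex_Icc (-1 : ℝ) 1).norm_image_sub_le_of_norm_hasDerivWithin_le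
      (fun y hy => h.hasDerivWithinAt_height x hy) (fun y hy => hC' _ ⟨mem_univ _, hy⟩) hz' hz
  -- The bound `(1 - m) / 2` keeps the collar off the bad set; `1 / (2 * C₁)` lets a quadratic
  -- quantity be beaten by a linear one in `aux`.
  set b := min (min b₀ (1 / 2)) (min ((1 - m) / 2) (1 / (2 * C₁)))
  have hb1 : b ≤ b₀ := (min_le_left _ _).trans (min_le_left _ _)
  have hb2 : b ≤ 1 / 2 := (min_le_left _ _).trans (min_le_right _ _)
  have hb3 : b ≤ (1 - m) / 2 := (min_le_right _ _).trans (min_le_left _ _)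
  have hb4 : b * (2 * C₁) ≤ 1 := by
    rw [← le_div_iff₀ (by positivity)]
    exact (min_le_right _ _).trans (min_le_right _ _)
  have hb : 0 < b := lt_min (lt_min hb₀ (by norm_num)) (lt_min (by linarith) (by positivity))
  refine ⟨b, hb, hb1, by linarith, fun p hp hpb => ⟨?_, ?_⟩⟩
  · obtain ⟨q, hq, -, h2, h3⟩ := hfract p hp
    rw [← h3]
    by_contra! hle
    have := hm q hq hle
    rw [h2] at this
    linarith
  · obtain ⟨x, z⟩ := p
    have hz := mem_strip.1 hp
    have he := mem_strip.1 (h.mapsTo hp)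
    simp only at hz
    have l1 := hlip x z (-1) hp.2 (by simp)
    have l2 := hlip x z 1 hp.2 (by simp)
    rw [hE.1, sub_neg_eq_add, sub_neg_eq_add, abs_of_nonneg (by linarith),
      abs_of_nonneg (by linarith)] at l1
    rw [hE.2, abs_of_nonpos (by linarith), abs_of_nonpos (by linarith)] at l2
    set e := (E (x, z)).2
    -- Here `s` is the distance of the height of `E` to the boundary, `u` that of the point itself,
    -- and `s ^ 2 * (3 - s) / 2` is the distance after applying `cubic`.
    have aux : ∀ s u : ℝ, 0 ≤ s → s ≤ b → 0 ≤ u → s ≤ C₁ * u → s ^ 2 * (3 - s) / 2 ≤ u := by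
      intro s u hs hsb hu hsu
      have a1 : s * s ≤ b * (C₁ * u) := mul_le_mul hsb hsu hs hb.le
      have a2 : b * (C₁ * u) ≤ u / 2 := by nlinarith
      nlinarith [mul_nonneg (mul_nonneg hs hs) hs]
    rcases le_abs.1 hpb with h1 | h1
    · refine mul_nonneg (by linarith) ?_
      have := aux (1 - e) (1 - z) (by linarith) (by linarith) (by linarith) (by linarith)
      have hcub : cubic e = 1 - (1 - e) ^ 2 * (3 - (1 - e)) / 2 := by
        rw [cubic]
        ring
      simp only
      linarith
    · refine mul_nonneg_of_nonpos_of_nonpos (by linarith) ?_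
      have := aux (1 + e) (z + 1) (by linarith) (by linarith) (by linarith) (by linarith)
      have hcub : cubic e = -1 + (1 + e) ^ 2 * (3 - (1 + e)) / 2 := by
        rw [cubic]
        ring
      simp only
      linarith

theorem bijOn_openStrip (h : StripDiffeo F E) : BijOn F openStrip openStrip := by
  refine ⟨h.mapsTo_openStrip, fun p hp q hq hpq => ?_, fun q hq => ?_⟩
  · rw [← h.left_inv p (openStrip_subset hp), hpq, h.left_inv q (openStrip_subset hq)]
  · exact ⟨E q, h.symm.mapsTo_openStrip hq, h.right_inv q (openStrip_subset hq)⟩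

end StripDiffeo

/-- A diffeomorphism of the open strip that commutes with the deck transformation and maps the
horizontal lines near the boundary to horizontal lines. -/
structure Straightened (G : ℝ × ℝ → ℝ × ℝ) (ε : ℝ) : Prop where
  smooth : ContDiffOn ℝ ∞ G openStrip
  bijOn : BijOn G openStrip openStrip
  jac_ne_zero : ∀ p ∈ openStrip, jac (fderiv ℝ G p) ≠ 0
  add_one : ∀ p ∈ openStrip, G (p + (1, 0)) = G p + (1, 0)
  pos : 0 < ε
  lt_one : ε < 1
  collar : ∀ p ∈ openStrip, 1 - ε ≤ |p.2| → (G p).2 = cubic p.2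

/-- A fibrewise increasing deformation of the strip along the verticals. -/
theorem bijOn_of_strictMonoOn {w : ℝ → ℝ → ℝ}
    (hc : ∀ x, ContinuousOn (w x) (Icc (-1) 1)) (hm : ∀ x, StrictMonoOn (w x) (Icc (-1) 1))
    (h1 : ∀ x, w x (-1) = -1) (h2 : ∀ x, w x 1 = 1) :
    BijOn (fun p : ℝ × ℝ => (p.1, w p.1 p.2)) openStrip openStrip := by
  have hl : (-1 : ℝ) ∈ Icc (-1 : ℝ) 1 := by simp
  have hr : (1 : ℝ) ∈ Icc (-1 : ℝ) 1 := by simp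
  refine ⟨?_, ?_, ?_⟩
  · rintro ⟨x, z⟩ ⟨-, hz⟩
    refine ⟨mem_univ _, ?_, ?_⟩
    · have := hm x hl (Ioo_subset_Icc_self hz) hz.1
      rwa [h1] at this
    · have := hm x (Ioo_subset_Icc_self hz) hr hz.2
      rwa [h2] at this
  · rintro ⟨x, z⟩ ⟨-, hz⟩ ⟨x', z'⟩ ⟨-, hz'⟩ he
    obtain ⟨rfl, he⟩ := Prod.mk.inj he
    exact Prod.ext rfl ((hm x).injOn (Ioo_subset_Icc_self hz) (Ioo_subset_Icc_self hz') he)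
  · rintro ⟨x, z⟩ ⟨-, hz⟩
    have hs := intermediate_value_Ioo (by norm_num) (hc x)
    rw [h1, h2] at hs
    obtain ⟨y, hy, hyz⟩ := hs hz
    exact ⟨(x, y), ⟨mem_univ _, hy⟩, Prod.ext rfl hyz⟩

theorem jac_fderiv_shear {w : ℝ × ℝ → ℝ} {q : ℝ × ℝ} (hw : DifferentiableAt ℝ w q)
    {w' : ℝ} (hw' : HasDerivAt (fun z => w (q.1, z)) w' q.2) :
    jac (fderiv ℝ (fun p : ℝ × ℝ => (p.1, w p)) q) = w' := by
  have h1 : HasFDerivAt (fun p : ℝ × ℝ => (p.1, w p))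
      ((ContinuousLinearMap.fst ℝ ℝ ℝ).prod (fderiv ℝ w q)) q :=
    hasFDerivAt_fst.prodMk hw.hasFDerivAt
  have h2 := (hasDerivAt_slice_snd (x := q.1) (z := q.2) hw).unique hw'
  rw [h1.fderiv]
  simp [jac, h2]

namespace StripDiffeo

variable {F E : ℝ × ℝ → ℝ × ℝ}

/-- A diffeomorphism of the strip can be deformed near the boundary into one that preserves the
horizontal lines there. -/
theorem exists_straightened (h : StripDiffeo F E) (hF : FixesEnds F) {b₀ : ℝ} (hb₀ : 0 < b₀) :
    ∃ G ε, Straightened G ε ∧ ∀ p : ℝ × ℝ, |p.2| ≤ 1 - b₀ → G p = F p := by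
  have hE := h.fixesEnds_symm hF
  obtain ⟨b, hb, hbb₀, hb1, hcol⟩ := h.symm.exists_collar hE hb₀
  obtain ⟨χ, hχ, hχ0, hχ1, hχin, hχout, hχ'⟩ := exists_cutoff hb hb1
  -- In the target coordinates `q = F p` the deformation is a vertical shear `W`, so that `G = W ∘
  -- F` and bijectivity reduces to monotonicity of `w` on verticals.
  set w : ℝ × ℝ → ℝ := fun q => (1 - χ (E q).2) * cubic (E q).2 + χ (E q).2 * q.2 with hw
  set W : ℝ × ℝ → ℝ × ℝ := fun q => (q.1, w q) with hW
  set G : ℝ × ℝ → ℝ × ℝ := fun p => ((F p).1, (1 - χ p.2) * cubic p.2 + χ p.2 * (F p).2) with hG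
  have hGW : ∀ p ∈ strip, G p = W (F p) := fun p hp => by
    simp only [hG, hW, hw, h.left_inv p hp]
  have hEs : ContDiffOn ℝ ∞ (fun q => (E q).2) strip := contDiff_snd.comp_contDiffOn h.smooth_inv
  have hws : ContDiffOn ℝ ∞ w strip :=
    ((contDiffOn_const.sub (hχ.comp_contDiffOn hEs)).mul (contDiff_cubic.comp_contDiffOn hEs)).add
      ((hχ.comp_contDiffOn hEs).mul contDiff_snd.contDiffOn)
  have hslice : ∀ x : ℝ, ∀ z ∈ Ioo (-1 : ℝ) 1, ∃ w' > 0, HasDerivAt (fun z => w (x, z)) w' z := by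
    intro x z hz
    have hp : (x, z) ∈ openStrip := ⟨mem_univ _, hz⟩
    have hd : HasDerivAt (fun z => (E (x, z)).2) (heightDeriv E (x, z)) z :=
      (h.symm.hasDerivWithinAt_height x (Ioo_subset_Icc_self hz)).hasDerivAt
        (Icc_mem_nhds hz.1 hz.2)
    have he := mem_openStrip.1 (h.symm.mapsTo_openStrip hp)
    have hcol' := hcol _ (openStrip_subset hp)
    set D := heightDeriv E (x, z)
    set e := (E (x, z)).2 with he_def
    have hχd : HasDerivAt (fun z => χ (E (x, z)).2) (deriv χ e * D) z :=
      HasDerivAt.comp (h₂ := χ) z (hχ.differentiable (by simp) e).hasDerivAt hd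
    have hcd : HasDerivAt (fun z => cubic (E (x, z)).2) ((3 - 3 * e ^ 2) / 2 * D) z :=
      HasDerivAt.comp (h₂ := cubic) z (hasDerivAt_cubic e) hd
    have hwd := ((hχd.const_sub 1).mul hcd).add (hχd.mul (hasDerivAt_id z))
    refine ⟨_, ?_, hwd⟩
    simp only [id, ← he_def, mul_one]
    rcases lt_or_ge |e| (1 - b) with hlt | hge
    · have hev : χ =ᶠ[𝓝 e] fun _ => 1 := by
        filter_upwards [continuous_abs.continuousAt.eventually_lt_const hlt] with y hy
        exact hχin y hy.le
      rw [hev.deriv_eq, hχin e hlt.le]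
      simp
    · obtain ⟨hD, hsgn⟩ := hcol' hge
      have he2 : 0 < e ^ 2 := by
        rw [← sq_abs]
        have : 0 < |e| := by linarith
        positivity
      have he3 : e ^ 2 < 1 := by nlinarith
      -- Both sign conditions carry a factor `e`: their product has the factor `e ^ 2`, which is
      -- divided out.
      have h1 : 0 ≤ deriv χ e * (z - cubic e) := by
        have := mul_nonneg (neg_nonneg.2 (hχ' e)) hsgn
        have h2 : 0 ≤ e ^ 2 * (deriv χ e * (z - cubic e)) := by
          simp only [] at this
          nlinarith
        exact (mul_nonneg_iff_of_pos_left he2).1 h2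
      have h2 : 0 ≤ D * (deriv χ e * (z - cubic e)) := mul_nonneg hD.le h1
      have h3 : 0 < (3 - 3 * e ^ 2) / 2 * D := mul_pos (by linarith) hD
      have h4 : 0 < (1 - χ e) * ((3 - 3 * e ^ 2) / 2 * D) + χ e := by
        rcases (hχ0 e).eq_or_lt with h0 | h0
        · rw [← h0]
          linarith
        · have := mul_nonneg (sub_nonneg.2 (hχ1 e)) h3.le
          linarith
      nlinarith
  have hone : ∀ y : ℝ, |y| = 1 → χ y = 0 := fun y hy => hχout y (by rw [hy]; linarith)
  have hbij : BijOn W openStrip openStrip := by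
    have hcont : ∀ x, ContinuousOn (fun z => w (x, z)) (Icc (-1) 1) := fun x =>
      hws.continuousOn.comp (by fun_prop) fun z hz => ⟨mem_univ _, hz⟩
    refine bijOn_of_strictMonoOn (w := fun x z => w (x, z)) hcont (fun x => ?_) ?_ ?_
    · refine strictMonoOn_of_deriv_pos (convex_Icc _ _) (hcont x) fun z hz => ?_
      rw [interior_Icc] at hz
      obtain ⟨w', hpos, hd⟩ := hslice x z hz
      rwa [hd.deriv]
    · intro x
      simp only [hw, hE.1 x, hone (-1) (by simp), cubic]
      norm_num
    · intro x
      simp only [hw, hE.2 x, hone 1 (by simp), cubic]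
      norm_num
  -- The cutoff vanishes once `|y| ≥ 1 - b / 2`, whence the collar width `b / 2`.
  refine ⟨G, b / 2, ⟨?_, ?_, ?_, ?_, by linarith, by linarith, ?_⟩, ?_⟩
  · have hF1 : ContDiffOn ℝ ∞ (fun p => (F p).1) openStrip :=
      contDiff_fst.comp_contDiffOn (h.smooth.mono openStrip_subset)
    have hF2 : ContDiffOn ℝ ∞ (fun p => (F p).2) openStrip :=
      contDiff_snd.comp_contDiffOn (h.smooth.mono openStrip_subset)
    have hχ2 : ContDiffOn ℝ ∞ (fun p : ℝ × ℝ => χ p.2) openStrip :=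
      (hχ.comp contDiff_snd).contDiffOn
    exact hF1.prodMk (((contDiffOn_const.sub hχ2).mul
      (contDiff_cubic.comp contDiff_snd).contDiffOn).add (hχ2.mul hF2))
  · exact (hbij.comp h.bijOn_openStrip).congr fun p hp => (hGW p (openStrip_subset hp)).symm
  · intro p hp
    have hev : G =ᶠ[𝓝 p] W ∘ F := by
      filter_upwards [strip_mem_nhds hp] with q hq using hGW q hq
    have hFp := h.mapsTo_openStrip hp
    have hwd : DifferentiableAt ℝ w (F p) :=
      (hws.contDiffAt (strip_mem_nhds hFp)).differentiableAt (by simp)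
    have hWd : DifferentiableAt ℝ W (F p) := differentiableAt_fst.prodMk hwd
    rw [hev.fderiv_eq, fderiv_comp p hWd ((h.contDiffAt hp).differentiableAt (by simp)), jac_comp]
    obtain ⟨w', hpos, hd⟩ := hslice (F p).1 (F p).2 hFp.2
    rw [jac_fderiv_shear hwd hd]
    exact mul_ne_zero hpos.ne' (h.jac_fderiv_ne_zero hp)
  · intro p hp
    simp only [hG, h.add_one p (openStrip_subset hp), Prod.fst_add, Prod.snd_add, add_zero]
    exact Prod.ext rfl (by simp)
  · intro p _ hp2
    simp only [hG, hχout p.2 (by linarith)]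
    ring
  · intro p hp
    simp only [hG, hχin p.2 (by linarith)]
    exact Prod.ext rfl (by simp)

end StripDiffeo

/-! ### The rearrangement with prescribed Jacobian -/

/-- The Jacobian of `G`, as a density on the strip. -/
noncomputable def density (G : ℝ × ℝ → ℝ × ℝ) (p : ℝ × ℝ) : ℝ := jac (fderiv ℝ G p)

/-- The integral of the density over a fundamental interval at height `y`. -/
noncomputable def fiberMass (G : ℝ × ℝ → ℝ × ℝ) (y : ℝ) : ℝ :=
  ∫ t in (0 : ℝ)..1, density G (t, y)

/-- The signed area `∮ y dθ` between the line `y = 0` and the image under `G` of a horizontal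
circle. -/
noncomputable def area (G : ℝ × ℝ → ℝ × ℝ) (y : ℝ) : ℝ :=
  ∫ t in (0 : ℝ)..1, (G (t, y)).2 * (fderiv ℝ G (t, y) (1, 0)).1

/-- The rearrangement of the strip that maps horizontal lines to horizontal lines and has the same
Jacobian as `G`. -/
noncomputable def rearrange (G : ℝ × ℝ → ℝ × ℝ) (p : ℝ × ℝ) : ℝ × ℝ :=
  ((G (0, p.2)).1 + (∫ t in (0 : ℝ)..p.1, density G (t, p.2)) / fiberMass G p.2, area G p.2)

theorem exists_lt_cubic {z δ : ℝ} (hz : z < 1) (hδ : 0 < δ) :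
    ∃ y, 1 - δ < y ∧ 0 < y ∧ y < 1 ∧ z < cubic y := by
  have h1 : Tendsto cubic (𝓝[<] 1) (𝓝 (cubic 1)) :=
    (hasDerivAt_cubic 1).continuousAt.continuousWithinAt
  have h2 : cubic 1 = 1 := by norm_num [cubic]
  rw [h2] at h1
  have h3 : ∀ᶠ y in 𝓝[<] (1 : ℝ), y ∈ Ioo (max (1 - δ) 0) 1 :=
    Ioo_mem_nhdsLT (max_lt (by linarith) zero_lt_one)
  obtain ⟨y, hy1, hy2⟩ := (h3.and (h1.eventually_const_lt hz)).exists
  exact ⟨y, (le_max_left _ _).trans_lt hy1.1, (le_max_right _ _).trans_lt hy1.1, hy1.2, hy2⟩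

theorem cubic_neg (y : ℝ) : cubic (-y) = -cubic y := by
  rw [cubic, cubic]
  ring

theorem cubic_lt_one {y : ℝ} (h0 : 0 < y) (h : y < 1) : cubic y < 1 := by
  rw [cubic]
  nlinarith [mul_pos (mul_pos (sub_pos.2 h) (sub_pos.2 h)) (by linarith : 0 < y + 2)]

namespace Straightened

variable {G : ℝ × ℝ → ℝ × ℝ} {ε : ℝ}

theorem mem {x y : ℝ} (hy : y ∈ Ioo (-1 : ℝ) 1) : (x, y) ∈ openStrip := ⟨mem_univ _, hy⟩

theorem contDiffAt (h : Straightened G ε) {p : ℝ × ℝ} (hp : p ∈ openStrip) :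
    ContDiffAt ℝ ∞ G p := h.smooth.contDiffAt (isOpen_openStrip.mem_nhds hp)

theorem differentiableAt (h : Straightened G ε) {p : ℝ × ℝ} (hp : p ∈ openStrip) :
    DifferentiableAt ℝ G p := (h.contDiffAt hp).differentiableAt (by simp)

theorem contDiffOn_fderiv (h : Straightened G ε) : ContDiffOn ℝ ∞ (fderiv ℝ G) openStrip :=
  h.smooth.fderiv_of_isOpen isOpen_openStrip (by simp)

theorem contDiffOn_fderiv_apply (h : Straightened G ε) (v : ℝ × ℝ) :
    ContDiffOn ℝ ∞ (fun p => fderiv ℝ G p v) openStrip :=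
  h.contDiffOn_fderiv.clm_apply contDiffOn_const

theorem contDiffOn_density (h : Straightened G ε) : ContDiffOn ℝ ∞ (density G) openStrip :=
  contDiff_jac.comp_contDiffOn h.contDiffOn_fderiv

theorem continuous_slice {f : ℝ × ℝ → ℝ} (hf : ContinuousOn f openStrip) {y : ℝ}
    (hy : y ∈ Ioo (-1 : ℝ) 1) : Continuous fun t => f (t, y) :=
  Cylinder.continuous_slice hf hy

theorem continuous_density (h : Straightened G ε) {y : ℝ} (hy : y ∈ Ioo (-1 : ℝ) 1) :
    Continuous fun t => density G (t, y) :=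
  continuous_slice h.contDiffOn_density.continuousOn hy

theorem fderiv_add_one (h : Straightened G ε) {p : ℝ × ℝ} (hp : p ∈ openStrip) :
    fderiv ℝ G (p + (1, 0)) = fderiv ℝ G p := by
  rw [← fderiv_comp_add_right]
  have : (fun q => G (q + (1, 0))) =ᶠ[𝓝 p] fun q => G q + (1, 0) := by
    filter_upwards [isOpen_openStrip.mem_nhds hp] with q hq using h.add_one q hq
  rw [this.fderiv_eq, fderiv_add_const]

theorem periodic_density (h : Straightened G ε) {y : ℝ} (hy : y ∈ Ioo (-1 : ℝ) 1) :
    Function.Periodic (fun t => density G (t, y)) 1 := by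
  intro t
  have := h.fderiv_add_one (p := (t, y)) (mem hy)
  simp only [Prod.mk_add_mk, add_zero] at this
  simp only [density, this]

theorem contDiffOn_areaIntegrand (h : Straightened G ε) :
    ContDiffOn ℝ ∞ (fun p => (G p).2 * (fderiv ℝ G p (1, 0)).1) openStrip :=
  (contDiff_snd.comp_contDiffOn h.smooth).mul
    (contDiff_fst.comp_contDiffOn (h.contDiffOn_fderiv_apply (1, 0)))

theorem contDiffOn_area (h : Straightened G ε) : ContDiffOn ℝ ∞ (area G) (Ioo (-1) 1) :=
  contDiffOn_intervalIntegral isOpen_Ioo h.contDiffOn_areaIntegrand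

theorem contDiffOn_fiberMass (h : Straightened G ε) : ContDiffOn ℝ ∞ (fiberMass G) (Ioo (-1) 1) :=
  contDiffOn_intervalIntegral isOpen_Ioo h.contDiffOn_density

/-- The mixed second derivatives of `G` agree. -/
theorem fderiv_fderiv_comm (h : Straightened G ε) {p : ℝ × ℝ} (hp : p ∈ openStrip)
    (u v : ℝ × ℝ) :
    fderiv ℝ (fun p => fderiv ℝ G p u) p v = fderiv ℝ (fun p => fderiv ℝ G p v) p u := by
  have hd : DifferentiableAt ℝ (fderiv ℝ G) p :=
    (h.contDiffOn_fderiv.contDiffAt (isOpen_openStrip.mem_nhds hp)).differentiableAt (by simp)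
  have key : ∀ w, fderiv ℝ (fun p => fderiv ℝ G p w) p = (fderiv ℝ (fderiv ℝ G) p).flip w := by
    intro w
    rw [fderiv_clm_apply hd (differentiableAt_const w)]
    simp
  rw [key, key]
  exact (h.contDiffAt hp).isSymmSndFDerivAt (by
    rw [minSmoothness_of_isRCLikeNormedField]
    exact WithTop.coe_le_coe.2 le_top) v u

/-- Green's formula. With `G = (G₁, G₂)`, the identity `∂_y (G₂ ∂_x G₁) - density = ∂_x (G₂ ∂_y G₁)`
follows from symmetry of second derivatives, and the right side integrates to zero over a period. -/
theorem hasDerivAt_area (h : Straightened G ε) {y : ℝ} (hy : y ∈ Ioo (-1 : ℝ) 1) :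
    HasDerivAt (area G) (fiberMass G y) y := by
  set g : ℝ × ℝ → ℝ := fun p => (G p).2 * (fderiv ℝ G p (1, 0)).1 with hg
  have hgs : ContDiffOn ℝ ∞ g openStrip := h.contDiffOn_areaIntegrand
  have hg1 : ContDiffOn ℝ 1 g (univ ×ˢ Ioo (-1) 1) := hgs.of_le (by norm_cast)
  have hgc : ContinuousOn (fun p => (fderiv ℝ g p).comp (ContinuousLinearMap.inr ℝ ℝ ℝ))
      openStrip :=
    (hg1.continuousOn_fderiv_of_isOpen isOpen_openStrip le_rfl).clm_comp continuousOn_const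
  have hd : HasDerivAt (area G) (∫ t in (0 : ℝ)..1, fderiv ℝ g (t, y) (0, 1)) y := by
    have h1 := (hasFDerivAt_intervalIntegral isOpen_Ioo hg1 hy).hasDerivAt
    rw [ContinuousLinearMap.intervalIntegral_apply
      ((Cylinder.continuous_slice hgc hy).intervalIntegrable _ _)] at h1
    exact h1.congr_deriv (by simp)
  set q : ℝ → ℝ := fun t => (G (t, y)).2 * (fderiv ℝ G (t, y) (0, 1)).1 with hq
  have hA : ∀ (v : ℝ × ℝ) (t : ℝ), DifferentiableAt ℝ (fun p => fderiv ℝ G p v) (t, y) :=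
    fun v t => ((h.contDiffOn_fderiv_apply v).contDiffAt
      (isOpen_openStrip.mem_nhds (mem hy))).differentiableAt (by simp)
  have hG : ∀ t : ℝ, DifferentiableAt ℝ G (t, y) := fun t => h.differentiableAt (mem hy)
  have hsnd : ∀ {f : ℝ → ℝ × ℝ} {f' : ℝ × ℝ} {s : ℝ}, HasDerivAt f f' s →
      HasDerivAt (fun s => (f s).2) f'.2 s := fun hf =>
    (ContinuousLinearMap.snd ℝ ℝ ℝ).hasFDerivAt.comp_hasDerivAt _ hf
  have hfst : ∀ {f : ℝ → ℝ × ℝ} {f' : ℝ × ℝ} {s : ℝ}, HasDerivAt f f' s →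
      HasDerivAt (fun s => (f s).1) f'.1 s := fun hf =>
    (ContinuousLinearMap.fst ℝ ℝ ℝ).hasFDerivAt.comp_hasDerivAt _ hf
  have hgy : ∀ t, fderiv ℝ g (t, y) (0, 1) =
      (fderiv ℝ G (t, y) (0, 1)).2 * (fderiv ℝ G (t, y) (1, 0)).1 +
        (G (t, y)).2 * (fderiv ℝ (fun p => fderiv ℝ G p (1, 0)) (t, y) (0, 1)).1 := by
    intro t
    have h1 : DifferentiableAt ℝ g (t, y) :=
      (hgs.contDiffAt (isOpen_openStrip.mem_nhds (mem hy))).differentiableAt (by simp)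
    exact (hasDerivAt_slice_snd h1).unique ((hsnd (hasDerivAt_slice_snd (hG t))).mul
      (hfst (hasDerivAt_slice_snd (hA (1, 0) t))))
  have hqd : ∀ t, HasDerivAt q (fderiv ℝ g (t, y) (0, 1) - density G (t, y)) t := by
    intro t
    have h1 := (hsnd (hasDerivAt_slice_fst (hG t))).mul
      (hfst (hasDerivAt_slice_fst (hA (0, 1) t)))
    refine h1.congr_deriv ?_
    rw [hgy, h.fderiv_fderiv_comm (mem hy) (1, 0) (0, 1), density, jac]
    ring
  have hgc' : Continuous fun t => fderiv ℝ g (t, y) (0, 1) := by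
    have := (Cylinder.continuous_slice hgc hy).clm_apply (continuous_const (y := (1 : ℝ)))
    simpa using this
  have hint := intervalIntegral.integral_eq_sub_of_hasDerivAt (fun t _ => hqd t)
    ((hgc'.sub (h.continuous_density hy)).intervalIntegrable 0 1)
  have hq1 : q 1 = q 0 := by
    have h1 := h.add_one (0, y) (mem hy)
    have h2 := h.fderiv_add_one (p := (0, y)) (mem hy)
    simp only [Prod.mk_add_mk, zero_add, add_zero] at h1 h2
    simp [hq, h1, h2]
  rw [hq1, sub_self, intervalIntegral.integral_sub (hgc'.intervalIntegrable _ _)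
    ((h.continuous_density hy).intervalIntegrable _ _), sub_eq_zero] at hint
  rwa [hint] at hd

theorem hasDerivAt_fst (h : Straightened G ε) {y : ℝ} (hy : y ∈ Ioo (-1 : ℝ) 1) (t : ℝ) :
    HasDerivAt (fun t => (G (t, y)).1) (fderiv ℝ G (t, y) (1, 0)).1 t :=
  (ContinuousLinearMap.fst ℝ ℝ ℝ).hasFDerivAt.comp_hasDerivAt t
    (hasDerivAt_slice_fst (h.differentiableAt (mem hy)))

theorem integral_fderiv_fst (h : Straightened G ε) {y : ℝ} (hy : y ∈ Ioo (-1 : ℝ) 1) (x : ℝ) :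
    ∫ t in (0 : ℝ)..x, (fderiv ℝ G (t, y) (1, 0)).1 = (G (x, y)).1 - (G (0, y)).1 :=
  intervalIntegral.integral_eq_sub_of_hasDerivAt (fun t _ => h.hasDerivAt_fst hy t)
    ((continuous_slice (continuous_fst.comp_continuousOn
      (h.contDiffOn_fderiv_apply (1, 0)).continuousOn) hy).intervalIntegrable _ _)

theorem fst_one (h : Straightened G ε) {y : ℝ} (hy : y ∈ Ioo (-1 : ℝ) 1) :
    (G (1, y)).1 - (G (0, y)).1 = 1 := by
  have h1 := h.add_one (0, y) (mem hy)
  simp only [Prod.mk_add_mk, zero_add, add_zero] at h1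
  rw [h1]
  simp

theorem area_eq_cubic (h : Straightened G ε) {y : ℝ} (hy : y ∈ Ioo (-1 : ℝ) 1)
    (hyε : 1 - ε ≤ |y|) : area G y = cubic y := by
  have h1 : ∀ t, (G (t, y)).2 = cubic y := fun t => h.collar (t, y) (mem hy) hyε
  simp only [area, h1]
  rw [intervalIntegral.integral_const_mul, h.integral_fderiv_fst hy, h.fst_one hy, mul_one]

theorem density_eq (h : Straightened G ε) {y : ℝ} (hy : y ∈ Ioo (-1 : ℝ) 1)
    (hyε : 1 - ε < |y|) (t : ℝ) :
    density G (t, y) = (fderiv ℝ G (t, y) (1, 0)).1 * ((3 - 3 * y ^ 2) / 2) := by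
  have hd : HasFDerivAt (fun p => (G p).2)
      ((ContinuousLinearMap.snd ℝ ℝ ℝ).comp (fderiv ℝ G (t, y))) (t, y) :=
    (ContinuousLinearMap.snd ℝ ℝ ℝ).hasFDerivAt.comp (t, y)
      (h.differentiableAt (mem hy)).hasFDerivAt
  have hc : HasFDerivAt (fun p : ℝ × ℝ => cubic p.2)
      (((3 - 3 * y ^ 2) / 2) • ContinuousLinearMap.snd ℝ ℝ ℝ) (t, y) :=
    HasDerivAt.comp_hasFDerivAt (f := Prod.snd) (t, y) (hasDerivAt_cubic y) hasFDerivAt_snd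
  have hev : (fun p => (G p).2) =ᶠ[𝓝 (t, y)] fun p => cubic p.2 := by
    have h1 : ∀ᶠ p : ℝ × ℝ in 𝓝 (t, y), 1 - ε < |p.2| :=
      (continuous_snd.abs.continuousAt (x := ((t, y) : ℝ × ℝ))).eventually_const_lt hyε
    filter_upwards [h1, isOpen_openStrip.mem_nhds (mem hy)] with p hp hps
    exact h.collar p hps hp.le
  have he := hd.unique (hc.congr_of_eventuallyEq hev)
  have e1 : (fderiv ℝ G (t, y) (1, 0)).2 = 0 := by
    have := congrArg (fun L => L ((1, 0) : ℝ × ℝ)) he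
    simpa using this
  have e2 : (fderiv ℝ G (t, y) (0, 1)).2 = (3 - 3 * y ^ 2) / 2 := by
    have := congrArg (fun L => L ((0, 1) : ℝ × ℝ)) he
    simpa using this
  rw [density, jac, e1, e2]
  ring

theorem integral_density_eq (h : Straightened G ε) {y : ℝ} (hy : y ∈ Ioo (-1 : ℝ) 1)
    (hyε : 1 - ε < |y|) (x : ℝ) :
    ∫ t in (0 : ℝ)..x, density G (t, y) =
      ((G (x, y)).1 - (G (0, y)).1) * ((3 - 3 * y ^ 2) / 2) := by
  simp only [h.density_eq hy hyε]
  rw [intervalIntegral.integral_mul_const, h.integral_fderiv_fst hy]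

theorem fiberMass_eq (h : Straightened G ε) {y : ℝ} (hy : y ∈ Ioo (-1 : ℝ) 1)
    (hyε : 1 - ε < |y|) : fiberMass G y = (3 - 3 * y ^ 2) / 2 := by
  rw [fiberMass, h.integral_density_eq hy hyε, h.fst_one hy, one_mul]

/-- The density has no zero on the connected open strip, and its integral along a collar line is
positive; so its sign is positive throughout. -/
theorem density_pos (h : Straightened G ε) {p : ℝ × ℝ} (hp : p ∈ openStrip) :
    0 < density G p := by
  have h0 := h.pos
  have h1 := h.lt_one
  have hy : 1 - ε / 2 ∈ Ioo (-1 : ℝ) 1 := ⟨by linarith, by linarith⟩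
  have hyε : 1 - ε < |1 - ε / 2| := by
    rw [abs_of_pos (by linarith)]
    linarith
  have hm : 0 < fiberMass G (1 - ε / 2) := by
    rw [h.fiberMass_eq hy hyε]
    nlinarith
  obtain ⟨t, ht⟩ : ∃ t, 0 < density G (t, 1 - ε / 2) := by
    by_contra! hc
    have h2 : 0 ≤ ∫ t in (0 : ℝ)..1, -density G (t, 1 - ε / 2) :=
      intervalIntegral.integral_nonneg_of_forall zero_le_one fun t => neg_nonneg.2 (hc t)
    rw [intervalIntegral.integral_neg, ← fiberMass] at h2
    linarith
  by_contra! hle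
  obtain ⟨q, hq, hq0⟩ := isPreconnected_openStrip.intermediate_value hp (mem hy)
    h.contDiffOn_density.continuousOn ⟨hle, ht.le⟩
  exact h.jac_ne_zero q hq hq0

theorem fiberMass_pos (h : Straightened G ε) {y : ℝ} (hy : y ∈ Ioo (-1 : ℝ) 1) :
    0 < fiberMass G y :=
  intervalIntegral.intervalIntegral_pos_of_pos ((h.continuous_density hy).intervalIntegrable _ _)
    (fun _ => h.density_pos (mem hy)) zero_lt_one

theorem strictMonoOn_area (h : Straightened G ε) : StrictMonoOn (area G) (Ioo (-1) 1) := by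
  refine strictMonoOn_of_deriv_pos (convex_Ioo _ _) h.contDiffOn_area.continuousOn fun y hy => ?_
  rw [interior_Ioo] at hy
  rw [(h.hasDerivAt_area hy).deriv]
  exact h.fiberMass_pos hy

/-- Monotonicity bounds `area G y` by its values at heights in the two collars, where it equals
`cubic`. -/
theorem mapsTo_area (h : Straightened G ε) : MapsTo (area G) (Ioo (-1) 1) (Ioo (-1) 1) := by
  intro y hy
  obtain ⟨y₂, h1, h2, h3, -⟩ := exists_lt_cubic hy.2 h.pos
  have hmax : max y y₂ ∈ Ioo (-1 : ℝ) 1 := ⟨lt_max_of_lt_left hy.1, max_lt hy.2 h3⟩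
  have hmin : min y (-y₂) ∈ Ioo (-1 : ℝ) 1 := ⟨lt_min hy.1 (by linarith), min_lt_of_left_lt hy.2⟩
  have hmax' : 0 < max y y₂ := lt_max_of_lt_right h2
  have hmin' : min y (-y₂) < 0 := min_lt_of_right_lt (by linarith)
  have e1 := h.area_eq_cubic hmax (by
    rw [abs_of_pos hmax']
    exact h1.le.trans (le_max_right _ _))
  have e2 := h.area_eq_cubic hmin (by
    rw [abs_of_neg hmin']
    have := min_le_right y (-y₂)
    linarith)
  have m1 := h.strictMonoOn_area.monotoneOn hy hmax (le_max_left _ _)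
  have m2 := h.strictMonoOn_area.monotoneOn hmin hy (min_le_left _ _)
  have c1 := cubic_lt_one hmax' hmax.2
  have c2 := cubic_lt_one (y := -min y (-y₂)) (by linarith) (by linarith [hmin.1])
  rw [cubic_neg] at c2
  exact ⟨by linarith, by linarith⟩

theorem surjOn_area (h : Straightened G ε) : SurjOn (area G) (Ioo (-1) 1) (Ioo (-1) 1) := by
  intro z hz
  obtain ⟨y₂, a1, a2, a3, a4⟩ := exists_lt_cubic hz.2 h.pos
  obtain ⟨y₁, b1, b2, b3, b4⟩ := exists_lt_cubic (z := -z) (by linarith [hz.1]) h.pos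
  have m2 : y₂ ∈ Ioo (-1 : ℝ) 1 := ⟨by linarith, a3⟩
  have m1 : -y₁ ∈ Ioo (-1 : ℝ) 1 := ⟨by linarith, by linarith⟩
  have e2 := h.area_eq_cubic m2 (by
    rw [abs_of_pos a2]
    exact a1.le)
  have e1 := h.area_eq_cubic m1 (by
    rw [abs_neg, abs_of_pos b2]
    exact b1.le)
  rw [cubic_neg] at e1
  have hsub : Icc (-y₁) y₂ ⊆ Ioo (-1 : ℝ) 1 := Icc_subset_Ioo m1.1 m2.2
  obtain ⟨y, hy, hyz⟩ := intermediate_value_Icc (by linarith)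
    (h.contDiffOn_area.continuousOn.mono hsub) (show z ∈ Icc _ _ by
      rw [e1, e2]
      exact ⟨by linarith, by linarith⟩)
  exact ⟨y, hsub hy, hyz⟩

/-- Substituting `t = x * s` moves the variable end point into the integrand. -/
theorem contDiffOn_primitive (h : Straightened G ε) :
    ContDiffOn ℝ ∞ (fun p : ℝ × ℝ => ∫ t in (0 : ℝ)..p.1, density G (t, p.2)) openStrip := by
  have h1 : ContDiffOn ℝ ∞ (fun p : ℝ × ℝ => ∫ t in (0 : ℝ)..1, density G (p.1 * t, p.2))
      openStrip := by
    refine contDiffOn_intervalIntegral (g := fun q : ℝ × (ℝ × ℝ) => density G (q.2.1 * q.1, q.2.2))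
      isOpen_openStrip ?_
    exact h.contDiffOn_density.comp (by fun_prop) fun q hq => mem hq.2.2
  refine (contDiff_fst.contDiffOn.mul h1).congr fun p hp => ?_
  have := intervalIntegral.smul_integral_comp_mul_left (a := 0) (b := 1)
    (fun t => density G (t, p.2)) p.1
  simpa using this.symm

theorem contDiffOn_rearrange (h : Straightened G ε) :
    ContDiffOn ℝ ∞ (rearrange G) openStrip := by
  have hm : MapsTo (fun p : ℝ × ℝ => p.2) openStrip (Ioo (-1) 1) := fun p hp => hp.2
  refine ContDiffOn.prodMk (ContDiffOn.add ?_ (ContDiffOn.div h.contDiffOn_primitive ?_ ?_)) ?_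
  · exact contDiff_fst.comp_contDiffOn (h.smooth.comp (by fun_prop) fun p hp => mem hp.2)
  · exact h.contDiffOn_fiberMass.comp contDiff_snd.contDiffOn hm
  · exact fun p hp => (h.fiberMass_pos hp.2).ne'
  · exact h.contDiffOn_area.comp contDiff_snd.contDiffOn hm

theorem hasDerivAt_rearrange_fst (h : Straightened G ε) {y : ℝ} (hy : y ∈ Ioo (-1 : ℝ) 1)
    (x : ℝ) :
    HasDerivAt (fun x => (rearrange G (x, y)).1) (density G (x, y) / fiberMass G y) x := by
  simp only [rearrange]
  exact (((h.continuous_density hy).integral_hasStrictDerivAt 0 x).hasDerivAt.div_const _).const_add _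

/-- The derivative is triangular, with diagonal entries `density / fiberMass` and `fiberMass`. -/
theorem jac_fderiv_rearrange (h : Straightened G ε) {p : ℝ × ℝ} (hp : p ∈ openStrip) :
    jac (fderiv ℝ (rearrange G) p) = jac (fderiv ℝ G p) := by
  obtain ⟨x, y⟩ := p
  have hy := hp.2
  have hd : DifferentiableAt ℝ (rearrange G) (x, y) :=
    (h.contDiffOn_rearrange.contDiffAt (isOpen_openStrip.mem_nhds hp)).differentiableAt (by simp)
  have h1 := (hasDerivAt_slice_fst hd).unique
    ((h.hasDerivAt_rearrange_fst hy x).prodMk (hasDerivAt_const x (area G y)))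
  have h2 := ((ContinuousLinearMap.snd ℝ ℝ ℝ).hasFDerivAt.comp_hasDerivAt y
    (hasDerivAt_slice_snd hd)).unique (h.hasDerivAt_area hy)
  simp only [ContinuousLinearMap.coe_snd'] at h2
  rw [jac, h1, h2]
  simp only [zero_mul, sub_zero]
  rw [div_mul_cancel₀ _ (h.fiberMass_pos hy).ne', density]

/-- The density is periodic, and division by `fiberMass` makes each period contribute exactly one.
-/
theorem rearrange_add_int (h : Straightened G ε) {x y : ℝ} (hy : y ∈ Ioo (-1 : ℝ) 1) (n : ℤ) :
    (rearrange G (x + n, y)).1 = (rearrange G (x, y)).1 + n := by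
  have hc := h.continuous_density hy
  have hp := (h.periodic_density hy).intervalIntegral_add_zsmul_eq n x
    fun _ _ => hc.intervalIntegrable _ _
  have h1 := (h.periodic_density hy).intervalIntegral_add_eq x 0
  rw [zero_add] at h1
  rw [h1, zsmul_one, zsmul_eq_mul] at hp
  have hadd := intervalIntegral.integral_add_adjacent_intervals
    (hc.intervalIntegrable (μ := MeasureTheory.volume) 0 x)
    (hc.intervalIntegrable (μ := MeasureTheory.volume) x (x + n))
  rw [hp] at hadd
  simp only [rearrange]
  rw [← hadd, add_div, ← fiberMass, mul_div_cancel_right₀ _ (h.fiberMass_pos hy).ne']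
  ring

theorem bijOn_rearrange (h : Straightened G ε) : BijOn (rearrange G) openStrip openStrip := by
  refine ⟨fun p hp => ⟨mem_univ _, h.mapsTo_area hp.2⟩, ?_, ?_⟩
  · rintro ⟨x, y⟩ hp ⟨x', y'⟩ hp' he
    obtain rfl : y = y' := h.strictMonoOn_area.injOn hp.2 hp'.2 (congrArg Prod.snd he)
    have hm : StrictMono fun x => (rearrange G (x, y)).1 := by
      refine strictMono_of_deriv_pos fun t => ?_
      rw [(h.hasDerivAt_rearrange_fst hp.2 t).deriv]
      exact div_pos (h.density_pos (mem hp.2)) (h.fiberMass_pos hp.2)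
    exact Prod.ext (hm.injective (congrArg Prod.fst he)) rfl
  · rintro ⟨u, v⟩ hp
    obtain ⟨y, hy, rfl⟩ := h.surjOn_area hp.2
    have hc : Continuous fun x => (rearrange G (x, y)).1 :=
      continuous_iff_continuousAt.2 fun x => (h.hasDerivAt_rearrange_fst hy x).continuousAt
    set c := (rearrange G (0, y)).1 with hcdef
    have key : ∀ n : ℤ, (rearrange G ((n : ℝ), y)).1 = c + n := fun n => by
      have := h.rearrange_add_int (x := 0) hy n
      rwa [zero_add] at this
    have hle : ((⌊u - c⌋ : ℤ) : ℝ) ≤ ((⌊u - c⌋ + 1 : ℤ) : ℝ) := by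
      push_cast
      linarith
    obtain ⟨x, -, hx⟩ := intermediate_value_Icc hle hc.continuousOn
      (show u ∈ Icc _ _ by
        rw [key, key]
        push_cast
        exact ⟨by linarith [Int.floor_le (u - c)], by linarith [Int.lt_floor_add_one (u - c)]⟩)
    exact ⟨(x, y), mem hy, Prod.ext hx rfl⟩

/-- In the collar the height of `G` depends on `y` only, so the normalised density is `∂_x` of the
first coordinate of `G`. The initial term `(G (0, y)).1` makes the primitive agree exactly. -/
theorem rearrange_eq (h : Straightened G ε) {p : ℝ × ℝ} (hp : p ∈ openStrip)
    (hpε : 1 - ε < |p.2|) : rearrange G p = G p := by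
  obtain ⟨x, y⟩ := p
  have hpos := h.fiberMass_pos hp.2
  have hm := h.fiberMass_eq hp.2 hpε
  refine Prod.ext ?_ ?_
  · simp only at hm hpos
    simp only [rearrange]
    rw [h.integral_density_eq hp.2 hpε, ← hm, mul_div_cancel_right₀ _ hpos.ne']
    ring
  · rw [h.collar _ hp hpε.le]
    exact h.area_eq_cubic hp.2 hpε.le

end Straightened

/-! ### Descent from the strip to the cylinder -/

section Descent

theorem exists_proj_eq (x : Cylinder) : ∃ p, ∃ hp : p ∈ strip, proj p hp = x := by
  obtain ⟨θ, y⟩ := x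
  obtain ⟨t, rfl⟩ := QuotientAddGroup.mk_surjective θ
  exact ⟨(t, y), ⟨mem_univ _, y.2⟩, rfl⟩

theorem isLift_iff {F : ℝ × ℝ → ℝ × ℝ} {f : Cylinder → Cylinder} (hm : MapsTo F strip strip) :
    IsLift F f ↔ ∀ p (hp : p ∈ strip), f (proj p hp) = proj (F p) (hm hp) := by
  refine ⟨fun h p hp => (h.proj_eq hp).symm, fun h θ y => ?_⟩
  have := h (θ, y) ⟨mem_univ _, y.2⟩
  exact ⟨(congrArg Prod.fst this).symm, (congrArg (fun x : Cylinder => (x.2 : ℝ)) this).symm⟩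

theorem exists_isLift {F : ℝ × ℝ → ℝ × ℝ} (hm : MapsTo F strip strip)
    (h1 : ∀ p ∈ strip, F (p + (1, 0)) = F p + (1, 0)) : ∃ f : Cylinder → Cylinder, IsLift F f := by
  choose r hr hrx using exists_proj_eq
  refine ⟨fun x => proj (F (r x)) (hm (hr x)), (isLift_iff hm).2 fun p hp => ?_⟩
  obtain ⟨n, hn⟩ := exists_int_of_proj_eq (hrx (proj p hp))
  have h2 : F (r (proj p hp)) = F p + ((n : ℝ), 0) := by rw [hn, add_int_of_add_one h1 hp]
  rw [← proj_add_int (hm hp) n]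
  congr 1

theorem StripDiffeo.exists_equiv {F E : ℝ × ℝ → ℝ × ℝ} (h : StripDiffeo F E) :
    ∃ φ : Cylinder ≃ Cylinder, IsLift F φ ∧ IsLift E φ.symm := by
  obtain ⟨f, hf⟩ := exists_isLift h.mapsTo h.add_one
  obtain ⟨g, hg⟩ := exists_isLift h.mapsTo_inv h.symm.add_one
  refine ⟨⟨f, g, fun x => ?_, fun x => ?_⟩, hf, hg⟩
  · obtain ⟨p, hp, rfl⟩ := exists_proj_eq x
    rw [← hf.proj_eq hp, ← hg.proj_eq (h.mapsTo hp)]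
    congr 1
    exact h.left_inv p hp
  · obtain ⟨p, hp, rfl⟩ := exists_proj_eq x
    rw [← hg.proj_eq hp, ← hf.proj_eq (h.mapsTo_inv hp)]
    congr 1
    exact h.right_inv p hp

theorem image_circle_subset {Φ F : ℝ × ℝ → ℝ × ℝ} {φ f : Cylinder → Cylinder} (hΦ : IsLift Φ φ)
    (hF : IsLift F f) {y y' : Icc (-1 : ℝ) 1} (h : ∀ θ : ℝ, ∃ θ' : ℝ, Φ (θ, y) = F (θ', y')) :
    φ '' circle y ⊆ f '' circle y' := by
  rintro _ ⟨⟨t, z⟩, ⟨-, hz⟩, rfl⟩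
  obtain rfl : z = y := hz
  obtain ⟨θ, rfl⟩ := QuotientAddGroup.mk_surjective t
  obtain ⟨θ', h'⟩ := h θ
  refine ⟨((θ' : AddCircle (1 : ℝ)), y'), ⟨mem_univ _, rfl⟩, Prod.ext ?_ (Subtype.ext ?_)⟩
  · rw [← (hF θ' y').1, ← h']
    exact (hΦ θ z).1
  · rw [← (hF θ' y').2, ← h']
    exact (hΦ θ z).2

end Descent

theorem mem_openStrip_iff_abs {p : ℝ × ℝ} : p ∈ openStrip ↔ |p.2| < 1 := by
  rw [mem_openStrip, abs_lt]

/-! ### Extension across the boundary by the identity -/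

section Extension

/-- The extension by the identity of a self-map of the open strip. -/
noncomputable def extend (H : ℝ × ℝ → ℝ × ℝ) (p : ℝ × ℝ) : ℝ × ℝ := if |p.2| < 1 then H p else p

theorem extend_of_mem {H : ℝ × ℝ → ℝ × ℝ} {p : ℝ × ℝ} (hp : p ∈ openStrip) : extend H p = H p :=
  if_pos (mem_openStrip_iff_abs.1 hp)

theorem extend_of_notMem {H : ℝ × ℝ → ℝ × ℝ} {p : ℝ × ℝ} (hp : p ∉ openStrip) : extend H p = p :=
  if_neg fun h => hp (mem_openStrip_iff_abs.2 h)

theorem extend_eq_self {H : ℝ × ℝ → ℝ × ℝ} {t : ℝ}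
    (hid : ∀ p ∈ openStrip, t < |p.2| → H p = p) {p : ℝ × ℝ} (hp : t < |p.2|) :
    extend H p = p := by
  by_cases h : p ∈ openStrip
  · rw [extend_of_mem h, hid p h hp]
  · exact extend_of_notMem h

theorem eventually_lt_abs_snd {t : ℝ} {p : ℝ × ℝ} (h : t < |p.2|) : ∀ᶠ q in 𝓝 p, t < |q.2| :=
  (continuous_snd.abs.continuousAt (x := p)).eventually_const_lt h

theorem contDiffOn_extend {H : ℝ × ℝ → ℝ × ℝ} (hH : ContDiffOn ℝ ∞ H openStrip) {t : ℝ}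
    (ht : t < 1) (hid : ∀ p ∈ openStrip, t < |p.2| → H p = p) :
    ContDiffOn ℝ ∞ (extend H) strip := by
  intro p _
  by_cases h : p ∈ openStrip
  · refine ((hH.contDiffAt (isOpen_openStrip.mem_nhds h)).congr_of_eventuallyEq
      ?_).contDiffWithinAt
    filter_upwards [isOpen_openStrip.mem_nhds h] with q hq using extend_of_mem hq
  · refine (contDiffAt_id.congr_of_eventuallyEq ?_).contDiffWithinAt
    have h1 : t < |p.2| := ht.trans_le (not_lt.1 fun h' => h (mem_openStrip_iff_abs.2 h'))
    filter_upwards [eventually_lt_abs_snd h1] with q hq using extend_eq_self hid hq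

theorem mapsTo_extend {H : ℝ × ℝ → ℝ × ℝ} (hm : MapsTo H openStrip openStrip) :
    MapsTo (extend H) strip strip := by
  intro p hp
  by_cases h : p ∈ openStrip
  · rw [extend_of_mem h]
    exact openStrip_subset (hm h)
  · rwa [extend_of_notMem h]

theorem extend_extend {H H' : ℝ × ℝ → ℝ × ℝ} (hm : MapsTo H openStrip openStrip)
    (hl : ∀ p ∈ openStrip, H' (H p) = p) (p : ℝ × ℝ) : extend H' (extend H p) = p := by
  by_cases h : p ∈ openStrip
  · rw [extend_of_mem h, extend_of_mem (hm h), hl p h]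
  · rw [extend_of_notMem h, extend_of_notMem h]

theorem stripDiffeo_extend {Φ Ψ : ℝ × ℝ → ℝ × ℝ} (hΦ : ContDiffOn ℝ ∞ Φ openStrip)
    (hΨ : ContDiffOn ℝ ∞ Ψ openStrip) (hm : MapsTo Φ openStrip openStrip)
    (hm' : MapsTo Ψ openStrip openStrip) (hl : ∀ p ∈ openStrip, Ψ (Φ p) = p)
    (hr : ∀ p ∈ openStrip, Φ (Ψ p) = p)
    (h1 : ∀ p ∈ openStrip, Φ (p + (1, 0)) = Φ p + (1, 0)) {t : ℝ} (ht : t < 1)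
    (hid : ∀ p ∈ openStrip, t < |p.2| → Φ p = p) : StripDiffeo (extend Φ) (extend Ψ) where
  smooth := contDiffOn_extend hΦ ht hid
  smooth_inv := contDiffOn_extend hΨ ht fun p hp hpt => by
    have := hl p hp
    rwa [hid p hp hpt] at this
  mapsTo := mapsTo_extend hm
  mapsTo_inv := mapsTo_extend hm'
  left_inv := fun p _ => extend_extend hm hl p
  right_inv := fun p _ => extend_extend hm' hr p
  add_one := fun p _ => by
    by_cases h : p ∈ openStrip
    · have h' : p + (1, 0) ∈ openStrip := by
        rw [mem_openStrip] at h ⊢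
        simpa using h
      rw [extend_of_mem h, extend_of_mem h', h1 p h]
    · have h' : p + (1, 0) ∉ openStrip := by
        rw [mem_openStrip] at h ⊢
        simpa using h
      rw [extend_of_notMem h, extend_of_notMem h']

end Extension

/-! ### The area-preserving map -/

/-- A straightened diffeomorphism, precomposed with the inverse of its rearrangement, extends to an
area preserving diffeomorphism of the strip that is the identity near the boundary. -/
theorem Straightened.exists_areaPreserving {G : ℝ × ℝ → ℝ × ℝ} {ε : ℝ} (h : Straightened G ε) :
    ∃ Φ Ψ t, StripDiffeo Φ Ψ ∧ t < 1 ∧ (∀ p : ℝ × ℝ, t < |p.2| → Φ p = p) ∧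
      (∀ p ∈ openStrip, Φ (rearrange G p) = G p) ∧
      ∀ p ∈ strip, jac (fderivWithin ℝ Φ strip p) = 1 := by
  set K := rearrange G with hK
  set K' := Function.invFunOn K openStrip with hK'
  set G' := Function.invFunOn G openStrip with hG'
  have hKb : BijOn K openStrip openStrip := h.bijOn_rearrange
  have hKi : InvOn K' K openStrip openStrip := hKb.invOn_invFunOn
  have hGi : InvOn G' G openStrip openStrip := h.bijOn.invOn_invFunOn
  have hK'm : MapsTo K' openStrip openStrip := hKb.surjOn.mapsTo_invFunOn
  have hG'm : MapsTo G' openStrip openStrip := h.bijOn.surjOn.mapsTo_invFunOn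
  have hjK : ∀ p ∈ openStrip, jac (fderiv ℝ K p) ≠ 0 := fun p hp => by
    rw [hK, h.jac_fderiv_rearrange hp]
    exact h.jac_ne_zero p hp
  have hK's : ContDiffOn ℝ ∞ K' openStrip := by
    intro q hq
    obtain ⟨p, hp, rfl⟩ := hKb.surjOn hq
    exact (contDiffAt_leftInverse isOpen_openStrip h.contDiffOn_rearrange hKi.1 hp
      (hjK p hp)).contDiffWithinAt
  have hG's : ContDiffOn ℝ ∞ G' openStrip := by
    intro q hq
    obtain ⟨p, hp, rfl⟩ := h.bijOn.surjOn hq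
    exact (contDiffAt_leftInverse isOpen_openStrip h.smooth hGi.1 hp
      (h.jac_ne_zero p hp)).contDiffWithinAt
  have hΦK : ∀ p ∈ openStrip, (G ∘ K') (K p) = G p := fun p hp => congrArg G (hKi.1 hp)
  have hΦs : ContDiffOn ℝ ∞ (G ∘ K') openStrip := h.smooth.comp hK's hK'm
  have hΦm : MapsTo (G ∘ K') openStrip openStrip := h.bijOn.mapsTo.comp hK'm
  have h1 : ∀ q ∈ openStrip, (G ∘ K') (q + (1, 0)) = (G ∘ K') q + (1, 0) := by
    intro q hq
    obtain ⟨p, hp, rfl⟩ := hKb.surjOn hq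
    have hp1 : p + (1, 0) ∈ openStrip := by
      rw [mem_openStrip] at hp ⊢
      simpa using hp
    have e : K p + (1, 0) = K (p + (1, 0)) := by
      refine Prod.ext ?_ ?_
      · have := h.rearrange_add_int (x := p.1) hp.2 1
        rw [Int.cast_one] at this
        simp only [Prod.fst_add, hK]
        rw [← Prod.mk.eta (p := p), Prod.mk_add_mk, add_zero]
        exact this.symm
      · simp [hK, rearrange]
    rw [e, hΦK _ hp1, hΦK _ hp, h.add_one p hp]
  have hε := h.pos
  have hε1 := h.lt_one
  obtain ⟨s, hsε, hs1⟩ := exists_between (show 1 - ε < 1 by linarith)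
  have hs : s ∈ Ioo (-1 : ℝ) 1 := ⟨by linarith, by linarith⟩
  have hs' : -s ∈ Ioo (-1 : ℝ) 1 := ⟨by linarith, by linarith⟩
  have hs0 : 0 < s := by linarith
  have as : area G s = cubic s := h.area_eq_cubic hs (by
    rw [abs_of_pos hs0]
    linarith)
  have as' : area G (-s) = -cubic s := by
    rw [← cubic_neg]
    refine h.area_eq_cubic hs' ?_
    rw [abs_neg, abs_of_pos hs0]
    linarith
  -- As `area G` is increasing with values `± cubic s` at `± s`, a point beyond height `cubic s`
  -- comes from beyond height `s`, hence from the collar where `K = G`.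
  have hid : ∀ q ∈ openStrip, cubic s < |q.2| → (G ∘ K') q = q := by
    intro q hq hqt
    obtain ⟨p, hp, rfl⟩ := hKb.surjOn hq
    have hps : 1 - ε < |p.2| := by
      have e : (K p).2 = area G p.2 := rfl
      rw [e] at hqt
      rcases lt_abs.1 hqt with h2 | h2
      · rw [← as, h.strictMonoOn_area.lt_iff_lt hs hp.2] at h2
        exact lt_of_lt_of_le (by linarith) (le_abs_self _)
      · have h3 : area G p.2 < area G (-s) := by linarith
        rw [h.strictMonoOn_area.lt_iff_lt hp.2 hs'] at h3
        exact lt_of_lt_of_le (by linarith) (neg_le_abs _)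
    rw [hΦK p hp, hK, h.rearrange_eq hp hps]
  have ht : cubic s < 1 := cubic_lt_one hs0 hs.2
  refine ⟨extend (G ∘ K'), extend (K ∘ G'), cubic s, ?_, ht, fun p hp => extend_eq_self hid hp,
    fun p hp => ?_, fun q hq => ?_⟩
  · refine stripDiffeo_extend hΦs (h.contDiffOn_rearrange.comp hG's hG'm) hΦm
      (hKb.mapsTo.comp hG'm) (fun p hp => ?_) (fun p hp => ?_) h1 ht hid
    · simp only [Function.comp_apply]
      rw [hGi.1 (hK'm hp), hKi.2 hp]
    · simp only [Function.comp_apply]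
      rw [hKi.1 (hG'm hp), hGi.2 hp]
  · rw [extend_of_mem (hKb.mapsTo hp)]
    exact hΦK p hp
  · by_cases hqo : q ∈ openStrip
    · obtain ⟨p, hp, rfl⟩ := hKb.surjOn hqo
      have hev : extend (G ∘ K') =ᶠ[𝓝 (K p)] G ∘ K' := by
        filter_upwards [isOpen_openStrip.mem_nhds hqo] with q hq using extend_of_mem hq
      rw [fderivWithin_of_mem_nhds (strip_mem_nhds hqo), hev.fderiv_eq]
      have hev' : (G ∘ K') ∘ K =ᶠ[𝓝 p] G := by
        filter_upwards [isOpen_openStrip.mem_nhds hp] with q hq using hΦK q hq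
      have hc := fderiv_comp p
        ((hΦs.contDiffAt (isOpen_openStrip.mem_nhds hqo)).differentiableAt (by simp))
        ((h.contDiffOn_rearrange.contDiffAt (isOpen_openStrip.mem_nhds hp)).differentiableAt
          (by simp))
      -- Since `Φ ∘ K = G` and the Jacobians of `K` and `G` agree and do not vanish, that of `Φ` is
      -- one.
      have hj := congrArg jac hc
      rw [hev'.fderiv_eq, jac_comp, ← h.jac_fderiv_rearrange hp] at hj
      exact (mul_eq_right₀ (hjK p hp)).1 hj.symm
    · have hq1 : cubic s < |q.2| := ht.trans_le (not_lt.1 fun h' => hqo (mem_openStrip_iff_abs.2 h'))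
      have hev : extend (G ∘ K') =ᶠ[𝓝 q] id := by
        filter_upwards [eventually_lt_abs_snd hq1] with p hp using extend_eq_self hid hp
      rw [(hev.filter_mono nhdsWithin_le_nhds).fderivWithin_eq hev.eq_of_nhds,
        fderivWithin_id (uniqueDiffOn_strip q hq), jac_id]

/-! ### Images of the straight circles and conclusion -/

theorem isBicurve_straight {y₁ y₂ : Icc (-1 : ℝ) 1} (h : y₁ < y₂) : IsBicurve (straight y₁ y₂) := by
  have hl : IsLift (fun p => p) (Equiv.refl Cylinder) := fun θ y => ⟨rfl, rfl⟩
  have hs : IsSmooth (Equiv.refl Cylinder) := ⟨fun p => p, contDiffOn_id, hl⟩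
  refine ⟨circle y₁, circle y₂, ?_, y₁, y₂, h, fun _ => Equiv.refl Cylinder,
    ⟨fun _ => ⟨hs, hs⟩, rfl, fun q => q.2, contDiff_snd.contDiffOn, fun _ => hl⟩, by simp, by simp⟩
  rw [circle, circle, ← prod_union]
  rfl

/-- The height of the line to which `rearrange G` moves the line at height `y`. -/
noncomputable def newHeight (G : ℝ × ℝ → ℝ × ℝ) (y : ℝ) : ℝ := if |y| < 1 then area G y else y

theorem Straightened.newHeight_mem {G : ℝ × ℝ → ℝ × ℝ} {ε : ℝ} (h : Straightened G ε) {y : ℝ}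
    (hy : y ∈ Icc (-1 : ℝ) 1) : newHeight G y ∈ Icc (-1 : ℝ) 1 := by
  rw [newHeight]
  split_ifs with hlt
  · exact Ioo_subset_Icc_self (h.mapsTo_area (abs_lt.1 hlt))
  · exact hy

theorem Straightened.newHeight_lt {G : ℝ × ℝ → ℝ × ℝ} {ε : ℝ} (h : Straightened G ε) {y y' : ℝ}
    (hy : y ∈ Icc (-1 : ℝ) 1) (hy' : y' ∈ Icc (-1 : ℝ) 1) (hlt : y < y') :
    newHeight G y < newHeight G y' := by
  rw [newHeight, newHeight]
  split_ifs with h1 h2 h2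
  · exact h.strictMonoOn_area (abs_lt.1 h1) (abs_lt.1 h2) hlt
  · have h3 := (h.mapsTo_area (abs_lt.1 h1)).2
    rw [abs_lt, not_and, not_lt] at h2
    linarith [h2 (by linarith [hy.1])]
  · have h3 := (h.mapsTo_area (abs_lt.1 h2)).1
    rw [abs_lt, not_and', not_lt] at h1
    linarith [h1 (by linarith [hy'.2])]
  · exact hlt

/-- An area preserving diffeomorphism built from a straightening of `F` moves the same circles
as `F`, up to a change of height. -/
theorem image_circle_newHeight {F E Φ G : ℝ × ℝ → ℝ × ℝ} {ε t b : ℝ} {φ f : Cylinder → Cylinder}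
    (hF : StripDiffeo F E) (hends : FixesEnds F) (hf : IsLift F f) (hG : Straightened G ε)
    (hGF : ∀ p : ℝ × ℝ, |p.2| ≤ 1 - b → G p = F p) (hφ : IsLift Φ φ)
    (ht : t < 1) (hid : ∀ p : ℝ × ℝ, t < |p.2| → Φ p = p)
    (hΦG : ∀ p ∈ openStrip, Φ (rearrange G p) = G p) (y : Icc (-1 : ℝ) 1)
    (hy : |(y : ℝ)| < 1 → |(y : ℝ)| ≤ 1 - b) :
    φ '' circle ⟨newHeight G y, hG.newHeight_mem y.2⟩ = f '' circle y := by
  have hEends := hF.fixesEnds_symm hends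
  by_cases hlt : |(y : ℝ)| < 1
  · have hyo : (y : ℝ) ∈ Ioo (-1 : ℝ) 1 := abs_lt.1 hlt
    have hnew : newHeight G y = area G y := if_pos hlt
    have key : ∀ θ : ℝ, Φ (rearrange G (θ, y)) = F (θ, y) := fun θ => by
      rw [hΦG _ ⟨mem_univ _, hyo⟩, hGF _ (hy hlt)]
    refine (image_circle_subset hφ hf fun u => ?_).antisymm (image_circle_subset hf hφ fun θ => ?_)
    · obtain ⟨⟨θ, z⟩, hp, he⟩ := hG.bijOn_rearrange.surjOn
        (show (u, area G y) ∈ openStrip from ⟨mem_univ _, hG.mapsTo_area hyo⟩)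
      obtain rfl : z = y := hG.strictMonoOn_area.injOn hp.2 hyo (congrArg Prod.snd he)
      refine ⟨θ, ?_⟩
      simp only [hnew]
      rw [← he, key]
    · refine ⟨(rearrange G (θ, y)).1, ?_⟩
      rw [← key]
      simp only [hnew]
      rfl
  -- A boundary circle: `Φ` fixes it pointwise and `F` maps it onto itself.
  · have h1 : |(y : ℝ)| = 1 := le_antisymm (abs_le.2 y.2) (not_lt.1 hlt)
    have hnew : newHeight G y = y := if_neg hlt
    have hys : ∀ u : ℝ, (u, (y : ℝ)) ∈ strip := fun u => ⟨mem_univ _, y.2⟩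
    have hline : ∀ {H : ℝ × ℝ → ℝ × ℝ}, FixesEnds H → ∀ u, H (u, y) = ((H (u, y)).1, (y : ℝ)) := by
      intro H hH u
      refine Prod.ext rfl ?_
      rcases (abs_eq zero_le_one).1 h1 with h2 | h2
      · rw [h2]
        exact hH.2 u
      · rw [h2]
        exact hH.1 u
    have key : ∀ u : ℝ, Φ (u, y) = (u, (y : ℝ)) := fun u => hid _ (by
      simp only
      rwa [h1])
    refine (image_circle_subset hφ hf fun u => ?_).antisymm (image_circle_subset hf hφ fun θ => ?_)
    · refine ⟨(E (u, y)).1, ?_⟩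
      simp only [hnew]
      rw [key, ← hline hEends, hF.right_inv _ (hys u)]
    · refine ⟨(F (θ, y)).1, ?_⟩
      simp only [hnew]
      rw [key, ← hline hends]

/-- A margin that separates the interior heights among `y₁`, `y₂` from the boundary. -/
theorem exists_margin (y₁ y₂ : ℝ) :
    ∃ b > 0, (|y₁| < 1 → |y₁| ≤ 1 - b) ∧ (|y₂| < 1 → |y₂| ≤ 1 - b) := by
  have key : ∀ y : ℝ, ∃ b > 0, |y| < 1 → |y| ≤ 1 - b := by
    intro y
    by_cases h : |y| < 1
    · exact ⟨1 - |y|, by linarith, fun _ => by linarith⟩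
    · exact ⟨1, one_pos, fun h' => absurd h' h⟩
  obtain ⟨b₁, h1, h1'⟩ := key y₁
  obtain ⟨b₂, h2, h2'⟩ := key y₂
  exact ⟨min b₁ b₂, lt_min h1 h2, fun h => by linarith [h1' h, min_le_left b₁ b₂],
    fun h => by linarith [h2' h, min_le_right b₁ b₂]⟩

theorem isCompactlySupported_of_isLift {Φ : ℝ × ℝ → ℝ × ℝ} {φ : Cylinder ≃ Cylinder}
    (hφ : IsLift Φ φ) {t : ℝ} (ht : t < 1) (hid : ∀ p : ℝ × ℝ, t < |p.2| → Φ p = p) :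
    IsCompactlySupported φ := by
  have hcl : IsClosed {x : Cylinder | |(x.2 : ℝ)| ≤ t} :=
    isClosed_le (by fun_prop) continuous_const
  refine (closure_minimal (fun x hx => ?_) hcl).trans fun x hx =>
    abs_lt.1 (lt_of_le_of_lt hx ht)
  by_contra hlt
  obtain ⟨p, hp, rfl⟩ := exists_proj_eq x
  refine hx ?_
  rw [← hφ.proj_eq hp]
  congr 1
  exact hid p (not_le.1 hlt)

end Cylinder

theorem mainTheorem11 (γ : Set Cylinder) (hγ : Cylinder.IsBicurve γ) :
    ∃ ym yp : Icc (-1 : ℝ) 1, ym < yp ∧ Cylinder.IsBicurve (Cylinder.straight ym yp) ∧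
      ∃ φ : Cylinder ≃ Cylinder,
        Cylinder.IsSymplecto φ ∧ Cylinder.IsCompactlySupported φ ∧
          φ '' Cylinder.straight ym yp = γ := by
  open Cylinder in
  obtain ⟨_, _, rfl, y₁, y₂, hlt, f, hf, rfl, rfl⟩ := hγ
  obtain ⟨F, E, hl, hF, hb, ht⟩ := hf.exists_stripDiffeo
  have hends : FixesEnds F := ⟨hb, ht⟩
  -- With this margin the straightening leaves `F` unchanged on whichever of the two lines is
  -- interior.
  obtain ⟨b, hb0, h1, h2⟩ := exists_margin y₁ y₂
  obtain ⟨G, ε, hG, hGF⟩ := hF.exists_straightened hends hb0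
  obtain ⟨Φ, Ψ, t, hΦ, ht1, hid, hΦG, hjac⟩ := hG.exists_areaPreserving
  obtain ⟨φ, hφ, hφ'⟩ := hΦ.exists_equiv
  have hlt' := hG.newHeight_lt y₁.2 y₂.2 hlt
  refine ⟨⟨newHeight G y₁, hG.newHeight_mem y₁.2⟩, ⟨newHeight G y₂, hG.newHeight_mem y₂.2⟩, hlt',
    isBicurve_straight hlt', φ, ⟨⟨⟨Φ, hΦ.smooth, hφ⟩, Ψ, hΦ.smooth_inv, hφ'⟩, Φ, hΦ.smooth, hφ, ?_⟩,
    isCompactlySupported_of_isLift hφ ht1 hid, ?_⟩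
  · intro p hp u v
    rw [omega_map, hjac p hp, one_mul]
  · have hs : ∀ y y' : Icc (-1 : ℝ) 1, straight y y' = circle y ∪ circle y' := fun y y' => by
      rw [circle, circle, ← prod_union]
      rfl
    rw [hs, image_union, image_circle_newHeight hF hends hl hG hGF hφ ht1 hid hΦG y₁ h1,
      image_circle_newHeight hF hends hl hG hGF hφ ht1 hid hΦG y₂ h2]
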